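/- Let $q>1$, $\delta>0$, let $m\ge 1$ be an integer, and put $\sigma_q f(t,z)=f(qt,z)$ for $t\in\mathbb C$, $z\in\mathbb C^d$; for $R>0$ let $D_R=\{z\in\mathbb C^d:\ |z_i|<R,\ i=1,\dots,d\}$. Consider the equation $$\sum_{j+\delta|\alpha|\le m} a_{j,\alpha}(t,z)\,(\sigma_q)^j\partial_z^\alpha X=F(t,z),\qquad(1)$$ where $a_{j,\alpha}$ ($j+\delta|\alpha|\le m$, $j\in\mathbb N$, $\alpha\in\mathbb N^d$) and $F$ are holomorphic in a neighborhood of $(0,0)\in\mathbb C\times\mathbb C^d$, and let $\hat X(t,z)=\sum_{n\ge0}X_n(z)t^n$, with all $X_n$ holomorphic on $D_R$ for some $R>0$, be a formal power series solution of (1). Let $\mathrm{ord}_t(f)=\min\{k\in\mathbb N:\ (\partial_t^kf)(0,z)\not\equiv0 \text{ near } z=0\}$ (and $\infty$ if there is no such $k$), and let $N$ be the convex hull in $\mathbb R^2$ of $\bigcup_{j+\delta|\alpha|\le m}\{(x,y):\ x\le j,\ y\ge \mathrm{ord}_t(a_{j,\alpha})\}$. Suppose that: (A$_1$) there is an integer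 $m_0$ with $0\le m_0<m$ and $N=\{(x,y)\in\mathbb R^2:\ x\le m,\ y\ge\max\{0,x-m_0\}\}$; (A$_2$) if $|\alpha|>0$ and $\mathrm{ord}_t(a_{j,\alpha})<\infty$, then $(j,\mathrm{ord}_t(a_{j,\alpha}))$ lies in the interior of $N$. These conditions imply $a_{j,0}(t,z)=t^{j-m_0}b_{j,0}(t,z)$ for $m_0<j\le m$, with $b_{j,0}$ holomorphic near $(0,0)$. Suppose also that $a_{m_0,0}(0,0)\ne0$ and $b_{m,0}(0,0)\ne0$. Put $$P(\tau,z)=\sum_{m_0<j\le m}\frac{b_{j,0}(0,z)}{q^{j(j-1)/2}}\tau^{j-m_0}+\frac{a_{m_0,0}(0,z)}{q^{m_0(m_0-1)/2}},$$ let $\tau_1,\dots,\tau_{m-m_0}$ be the roots of $P(\tau,0)=0$ (all nonzero), and let $S=\bigcup_{i}\{\tau_i\eta:\ \eta>0\}$. Let $$u(\xi,z)=\sum_{k\ge0}\frac{X_k(z)}{q^{k(k-1)/2}}\,\xi^k$$ be the formal $q$-Borel transform of $\hat X$, and for $\lambda\ne0$, $\theta>0$ let $S_\theta(\lambda)=\{\xi\in\mathbb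 C\setminus\{0\}:\ |\arg\xi-\arg\lambda|<\theta\}$ (difference of arguments modulo $2\pi$). **Proposition 2.4.** For every $\lambda\in\mathbb C\setminus(\{0\}\cup S)$ there are $\theta>0$, $0<R_1<R$, $r>0$, $C>0$ and $H>0$ such that the series $u(\xi,z)$ converges to a holomorphic function on $\{|\xi|<r\}\times D_{R_1}$, and $u$ has an analytic extension $u^*(\xi,z)$ to $S_\theta(\lambda)\times D_{R_1}$ (that is, $u^*$ is holomorphic there and $u^*=u$ where moreover $|\xi|<r$) satisfying $$|u^*(\lambda q^n,z)|\le C\,H^n\,q^{n^2/2}\quad\text{for all } z\in D_{R_1},\ n=0,1,2,\dots.$$ -/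

import Mathlib

open Filter Topology

noncomputable section

namespace QDiffDiff

/-- The polydisc `D_R = {z ∈ ℂ^d ; |z_i| < R for all i}`. -/
def polydisc (d : ℕ) (R : ℝ) : Set (Fin d → ℂ) := {z | ∀ i, ‖z i‖ < R}

/-- The length `|α| = α_1 + ... + α_d` of a multi-index. -/
def len {d : ℕ} (α : Fin d → ℕ) : ℕ := ∑ i, α i

open Classical in
/-- The finite set of indices `(j, α)` with `j + δ |α| ≤ m`, for `δ > 0`; see `mem_indexSet`. -/
def indexSet (d m : ℕ) (δ : ℝ) : Finset (ℕ × (Fin d → ℕ)) :=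
  (Finset.range (m + 1) ×ˢ Fintype.piFinset (fun _ => Finset.range (⌊(m : ℝ) / δ⌋₊ + 1))).filter
    (fun p => (p.1 : ℝ) + δ * (len p.2 : ℝ) ≤ (m : ℝ))

theorem mem_indexSet {d m : ℕ} {δ : ℝ} (hδ : 0 < δ) (p : ℕ × (Fin d → ℕ)) :
    p ∈ indexSet d m δ ↔ (p.1 : ℝ) + δ * (len p.2 : ℝ) ≤ (m : ℝ) := by
  unfold indexSet
  rw [Finset.mem_filter]
  refine ⟨fun h => h.2, fun h => ⟨?_, h⟩⟩
  have h0 : 0 ≤ δ * (len p.2 : ℝ) := by positivity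
  have h1 : (p.1 : ℝ) ≤ m := by linarith
  have h2 : (len p.2 : ℝ) ≤ m / δ := by
    rw [le_div_iff₀ hδ]
    have : (0 : ℝ) ≤ p.1 := Nat.cast_nonneg _
    linarith
  rw [Finset.mem_product, Fintype.mem_piFinset]
  refine ⟨Finset.mem_range.2 (Nat.lt_succ_of_le (by exact_mod_cast h1)), fun i => ?_⟩
  have h3 : p.2 i ≤ len p.2 := Finset.single_le_sum (fun _ _ => Nat.zero_le _) (Finset.mem_univ i)
  exact Finset.mem_range.2 (Nat.lt_succ_of_le (h3.trans (Nat.le_floor h2)))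

/-- The coefficient of `t^k` in the Taylor expansion of `f(t, z)` at `t = 0`, a function of `z`. -/
def tCoeff {d : ℕ} (f : ℂ × (Fin d → ℂ) → ℂ) (k : ℕ) (z : Fin d → ℂ) : ℂ :=
  iteratedDeriv k (fun t => f (t, z)) 0 / (k.factorial : ℂ)

/-- `ord_t(f)`: the least `k` such that `(∂_t^k f)(0, z)` does not vanish identically near `z = 0`
(it is `⊤` if there is no such `k`). -/
def ordT {d : ℕ} (f : ℂ × (Fin d → ℂ) → ℂ) : ℕ∞ :=
  ⨅ (k : ℕ) (_ : ¬ ∀ᶠ z in 𝓝 (0 : Fin d → ℂ), iteratedDeriv k (fun t => f (t, z)) 0 = 0), (k : ℕ∞)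

/-- The partial derivative `∂f/∂z_i`. -/
def partialDz {d : ℕ} (i : Fin d) (f : (Fin d → ℂ) → ℂ) : (Fin d → ℂ) → ℂ :=
  fun z => fderiv ℂ f z (Pi.single i 1)

/-- The iterated partial derivative `∂_z^α f = ∂_{z_1}^{α_1} ⋯ ∂_{z_d}^{α_d} f`. -/
def multiDz {d : ℕ} (α : Fin d → ℕ) (f : (Fin d → ℂ) → ℂ) : (Fin d → ℂ) → ℂ :=
  (List.finRange d).foldr (fun i g => (partialDz i)^[α i] g) f

/-- The `q`-shift `X(t, z) ↦ X(q t, z)` on formal series `X = ∑ X_n(z) t^n`, represented by their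
coefficient sequences. -/
def qShift {d : ℕ} (q : ℝ) (X : ℕ → (Fin d → ℂ) → ℂ) : ℕ → (Fin d → ℂ) → ℂ :=
  fun n z => (q : ℂ) ^ n * X n z

/-- The product of the Taylor series of `f` in `t` with a formal series `X = ∑ X_n(z) t^n`. -/
def mulSeries {d : ℕ} (f : ℂ × (Fin d → ℂ) → ℂ) (X : ℕ → (Fin d → ℂ) → ℂ) :
    ℕ → (Fin d → ℂ) → ℂ :=
  fun n z => ∑ kl ∈ Finset.HasAntidiagonal.antidiagonal n, tCoeff f kl.1 z * X kl.2 z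

/-- `X = ∑ X_n(z) t^n` is a formal solution of
`∑_{j + δ|α| ≤ m} a_{j,α}(t,z) (σ_q)^j ∂_z^α X = F(t,z)`: for every `n`, the coefficients of `t^n`
of the two sides coincide near `z = 0`. -/
def IsFormalSolution {d : ℕ} (q δ : ℝ) (m : ℕ) (a : ℕ × (Fin d → ℕ) → ℂ × (Fin d → ℂ) → ℂ)
    (F : ℂ × (Fin d → ℂ) → ℂ) (X : ℕ → (Fin d → ℂ) → ℂ) : Prop :=
  ∀ n : ℕ, ∀ᶠ z in 𝓝 (0 : Fin d → ℂ),
    ∑ p ∈ indexSet d m δ, mulSeries (a p) ((qShift q)^[p.1] (fun k => multiDz p.2 (X k))) n z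
      = tCoeff F n z

/-- The quadrant `C(a, b) = {(x, y) ; x ≤ a, y ≥ b}`. -/
def quadrant (a b : ℝ) : Set (ℝ × ℝ) := {p | p.1 ≤ a ∧ b ≤ p.2}

/-- The `t`-Newton polygon: the convex hull of the union of the quadrants
`C(j, ord_t(a_{j,α}))`, `j + δ|α| ≤ m` (the quadrant is empty when `ord_t(a_{j,α}) = ∞`). -/
def newtonPolygon {d : ℕ} (δ : ℝ) (m : ℕ) (a : ℕ × (Fin d → ℕ) → ℂ × (Fin d → ℂ) → ℂ) :
    Set (ℝ × ℝ) :=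
  convexHull ℝ (⋃ p ∈ indexSet d m δ, ⋃ (k : ℕ) (_ : ordT (a p) = k), quadrant p.1 k)

/-- Condition (A₁): the `t`-Newton polygon is `{(x, y) ; x ≤ m, y ≥ max {0, x - m₀}}`. -/
def CondA1 {d : ℕ} (δ : ℝ) (m m₀ : ℕ) (a : ℕ × (Fin d → ℕ) → ℂ × (Fin d → ℂ) → ℂ) : Prop :=
  newtonPolygon δ m a = {p : ℝ × ℝ | p.1 ≤ m ∧ max 0 (p.1 - m₀) ≤ p.2}

/-- Condition (A₂): `(j, ord_t(a_{j,α}))` is an interior point of the `t`-Newton polygon whenever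
`|α| > 0` (no condition if `ord_t(a_{j,α}) = ∞`). -/
def CondA2 {d : ℕ} (δ : ℝ) (m : ℕ) (a : ℕ × (Fin d → ℕ) → ℂ × (Fin d → ℂ) → ℂ) : Prop :=
  ∀ p ∈ indexSet d m δ, 0 < len p.2 → ∀ k : ℕ, ordT (a p) = k →
    ((p.1 : ℝ), (k : ℝ)) ∈ interior (newtonPolygon δ m a)

/-- The function `b_{j,0}` with `a_{j,0}(t,z) = t^{j-m₀} b_{j,0}(t,z)` (for `m₀ < j ≤ m`, when
`ord_t(a_{j,0}) ≥ j - m₀`); its value at `t = 0` is the coefficient of `t^{j-m₀}` in `a_{j,0}`. -/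
def bFun {d : ℕ} (m₀ : ℕ) (a : ℕ × (Fin d → ℕ) → ℂ × (Fin d → ℂ) → ℂ) (j : ℕ) :
    ℂ × (Fin d → ℂ) → ℂ :=
  fun w => if w.1 = 0 then tCoeff (a (j, 0)) (j - m₀) w.2 else a (j, 0) w / w.1 ^ (j - m₀)

/-- The polynomial `P(τ, z) = ∑_{m₀ < j ≤ m} b_{j,0}(0,z) q^{-j(j-1)/2} τ^{j-m₀}
+ a_{m₀,0}(0,z) q^{-m₀(m₀-1)/2}` (the divisions by `2` in the exponents are exact). -/
def charPoly {d : ℕ} (q : ℝ) (m m₀ : ℕ) (a : ℕ × (Fin d → ℕ) → ℂ × (Fin d → ℂ) → ℂ)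
    (τ : ℂ) (z : Fin d → ℂ) : ℂ :=
  ∑ j ∈ Finset.Ioc m₀ m, bFun m₀ a j (0, z) / (q : ℂ) ^ (j * (j - 1) / 2) * τ ^ (j - m₀)
    + a (m₀, 0) (0, z) / (q : ℂ) ^ (m₀ * (m₀ - 1) / 2)

/-- The set `S` of singular directions: the union of the open half-lines `{τ η ; η > 0}`, where
`τ` runs through the roots of `P(τ, 0) = 0`. -/
def singularDirections {d : ℕ} (q : ℝ) (m m₀ : ℕ)
    (a : ℕ × (Fin d → ℕ) → ℂ × (Fin d → ℂ) → ℂ) : Set ℂ :=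
  {t | ∃ τ : ℂ, charPoly q m m₀ a τ 0 = 0 ∧ ∃ η : ℝ, 0 < η ∧ t = τ * (η : ℂ)}

/-- The sector `S_θ(λ) = {ξ ≠ 0 ; |arg ξ - arg λ| < θ}`, the difference of the arguments being
taken modulo `2π`. -/
def sector (θ : ℝ) (lam : ℂ) : Set ℂ := {ξ | ξ ≠ 0 ∧ |(ξ / lam).arg| < θ}

/-- The terms `X_k(z) ξ^k / q^{k(k-1)/2}` of the formal `q`-Borel transform of `∑ X_k(z) t^k`. -/
def borelTerm {d : ℕ} (q : ℝ) (X : ℕ → (Fin d → ℂ) → ℂ) (ξ : ℂ) (z : Fin d → ℂ) (k : ℕ) : ℂ :=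
  X k z / (q : ℂ) ^ (k * (k - 1) / 2) * ξ ^ k

/-- The sum `u(ξ, z)` of the formal `q`-Borel transform of `∑ X_k(z) t^k`. -/
def qBorel {d : ℕ} (q : ℝ) (X : ℕ → (Fin d → ℂ) → ℂ) (w : ℂ × (Fin d → ℂ)) : ℂ :=
  ∑' k : ℕ, borelTerm q X w.1 w.2 k

end QDiffDiff

end

open QDiffDiff

/-! Write `X_n = q^{n(n-1)/2} u_n` and divide the coefficient of `t^n` in the equation by
`q^{N(N-1)/2}`, where `N = n + m₀`. Up to a constant, `t^i σ_q^j ∂_z^α` becomes `u ↦ ξ^i (∂_z^α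
u)(ξ/q^s, z)` with `s = i + m₀ - j`, and the constant carries a factor `q^{-s(s-1)/2 - js}`. By (A₁)
only `s ≥ 0` occurs, and by (A₂) only `s ≥ 1` when `|α| > 0`. The terms with `s = 0` add up to
`P(ξ,z) u(ξ,z)`, so `P u = f - (terms in u(ξ/q^s, z), s ≥ 1)` (`borel_recurrence`,
`borelSum_equation`).

Convergence near `ξ = 0` (`exists_norm_borelCoeff_le`): the recurrence for `u_n` has a leading
factor bounded away from `0`, because `a_{m₀,0}(0,0) ≠ 0`. Derivatives in `z` are handled by
Cauchy's estimate on balls of radius `R(1 + κ^{-n})`, where `κ^L = q` and `L` bounds every `|α|`;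
this costs `C q^n`. A term with `|α| > 0` has `s ≥ 1`, so it brings `q^{-l}` with `u_l`, and the net
loss `q^{n-l}` is geometric.

Extension (`approxExtension_spec`): for `|ξ| < r q^{k+1}` the terms with `s ≥ 1` see `u` only on
`|ξ| < r q^k`, so the equation, divided by `P`, extends `u` step by step. On a thin sector around `λ
∉ S` one has `|P| ≥ ε(1+|ξ|)^{m-m₀}` (`exists_le_norm_mainPoly`). The bound `|u| ≤ K q^{(n+x)²/2}`
on `|ξ| < r q^n` is propagated by induction. The powers `q^{n(m-m₀)}` cancel against `P`; the loss
`q^n` of a derivative is paid by `j < m`, which `δ > 0` forces when `|α| > 0`; and a large `x` makes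
the perturbation at most half of the allowed bound (`pow_mul_gaussGrowth_le`). Osgood's lemma gives
the joint holomorphy of all the series in `(ξ, z)`. -/

namespace QDiffDiff

/-! ### Cauchy's formula on polydiscs and Osgood's lemma. -/

section Osgood

open MeasureTheory Metric

variable {n : ℕ}

theorem torusMap_mem_closedBall {c : Fin n → ℂ} {ρ : ℝ} (hρ : 0 ≤ ρ) (θ : Fin n → ℝ) :
    torusMap c (fun _ => ρ) θ ∈ closedBall c ρ := by
  rw [mem_closedBall, dist_pi_le_iff hρ]
  intro i
  simp [torusMap, dist_eq_norm, Complex.norm_exp_ofReal_mul_I, abs_of_nonneg hρ]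

theorem continuous_torusMap (c : Fin n → ℂ) (R : Fin n → ℝ) : Continuous (torusMap c R) := by
  unfold torusMap
  fun_prop

theorem le_norm_torusMap_sub (c z : Fin n → ℂ) (ρ : ℝ) (θ : Fin n → ℝ)
    (i : Fin n) : ρ - dist z c ≤ ‖torusMap c (fun _ => ρ) θ i - z i‖ := by
  have h1 : ‖z i - c i‖ ≤ dist z c := by
    rw [← dist_eq_norm]
    exact dist_le_pi_dist z c i
  have h2 : ‖(ρ : ℂ) * Complex.exp (θ i * Complex.I)‖ = |ρ| := by
    simp [Complex.norm_exp_ofReal_mul_I]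
  have h3 : torusMap c (fun _ => ρ) θ i - z i
      = (ρ : ℂ) * Complex.exp (θ i * Complex.I) - (z i - c i) := by
    simp only [torusMap]; ring
  rw [h3]
  have h4 := norm_sub_norm_le ((ρ : ℂ) * Complex.exp (θ i * Complex.I)) (z i - c i)
  have h5 := le_abs_self ρ
  linarith

theorem continuous_cauchyKernel_mul {f : (Fin n → ℂ) → ℂ} {c z : Fin n → ℂ} {ρ : ℝ} (hρ : 0 < ρ)
    (hf : ContinuousOn f (closedBall c ρ)) (hz : z ∈ ball c ρ) :
    Continuous fun θ : Fin n → ℝ => (∏ i, (torusMap c (fun _ => ρ) θ i - z i)⁻¹) *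
      f (torusMap c (fun _ => ρ) θ) := by
  have hc := continuous_torusMap c (fun _ => ρ)
  refine Continuous.mul (continuous_finsetProd _ fun i _ => Continuous.inv₀ ?_ fun θ h => ?_) ?_
  · exact ((continuous_apply i).comp hc).sub continuous_const
  · have := le_norm_torusMap_sub c z ρ θ i
    rw [h, norm_zero] at this
    rw [mem_ball] at hz
    linarith
  · exact hf.comp_continuous hc fun θ => torusMap_mem_closedBall hρ.le θ

theorem ring_inverse_eq_of_mul_eq_one {A : Type*} [CommRing A] {a b : A} (h : a * b = 1) :
    Ring.inverse a = b := by
  rw [← one_mul b, ← Ring.inverse_mul_cancel a (IsUnit.of_mul_eq_one b h), mul_assoc, h, mul_one]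

/-- Cauchy's integral formula on a polydisc. -/
theorem torusIntegral_cauchyKernel_mul {ρ : ℝ} (hρ : 0 < ρ) (f : (Fin n → ℂ) → ℂ) (c : Fin n → ℂ)
    (hf : ContinuousOn f (closedBall c ρ))
    (hd : ∀ z ∈ closedBall c ρ, ∀ i,
      DifferentiableAt ℂ (fun w => f (Function.update z i w)) (z i))
    {z : Fin n → ℂ} (hz : z ∈ ball c ρ) :
    torusIntegral (fun w => (∏ i, (w i - z i)⁻¹) * f w) c (fun _ => ρ)
      = (2 * Real.pi * Complex.I) ^ n * f z := by
  induction n with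
  | zero =>
    rw [torusIntegral_dim0]
    simp [Subsingleton.elim z c]
  | succ n ih =>
    have hint : TorusIntegrable (fun w => (∏ i, (w i - z i)⁻¹) * f w) c (fun _ => ρ) :=
      (continuous_cauchyKernel_mul hρ hf hz).continuousOn.integrableOn_compact isCompact_Icc
    rw [torusIntegral_succ hint]
    have hcons : ∀ x y, Fin.cons x y ∈ closedBall c ρ ↔
        x ∈ closedBall (c 0) ρ ∧ y ∈ closedBall (c ∘ Fin.succ) ρ := by
      intro x y
      rw [mem_closedBall, mem_closedBall, mem_closedBall, dist_pi_le_iff hρ.le,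
        dist_pi_le_iff hρ.le, Fin.forall_fin_succ]
      simp
    have hz0 : z 0 ∈ ball (c 0) ρ := by
      rw [mem_ball] at hz ⊢
      exact (dist_le_pi_dist z c 0).trans_lt hz
    have hzt : (z ∘ Fin.succ) ∈ ball (c ∘ Fin.succ) ρ := by
      rw [mem_ball, dist_pi_lt_iff hρ] at hz ⊢
      exact fun i => hz i.succ
    have hzc : Fin.cons (z 0) (z ∘ Fin.succ) = z := Fin.cons_self_tail z
    -- The induction hypothesis evaluates the integral in the last `n` variables for `x` fixed on
    -- the circle; the one-variable Cauchy formula then handles `x`.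
    have key : ∀ x ∈ sphere (c 0) ρ,
        torusIntegral (fun y => (∏ i, ((Fin.cons x y : Fin (n + 1) → ℂ) i - z i)⁻¹) *
          f (Fin.cons x y)) (c ∘ Fin.succ) ((fun _ => ρ) ∘ Fin.succ)
        = (2 * Real.pi * Complex.I) ^ n * ((x - z 0)⁻¹ • f (Fin.cons x (z ∘ Fin.succ))) := by
      intro x hx
      have hx' := sphere_subset_closedBall hx
      have := ih (fun y => f (Fin.cons x y)) (c ∘ Fin.succ) ?_ ?_ hzt
      · have h2 : (fun y : Fin n → ℂ => (∏ i, ((Fin.cons x y : Fin (n + 1) → ℂ) i - z i)⁻¹) *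
            f (Fin.cons x y)) = fun y => (x - z 0)⁻¹ * ((∏ i, (y i - (z ∘ Fin.succ) i)⁻¹) *
            f (Fin.cons x y)) := by
          ext y
          rw [Fin.prod_univ_succ]
          simp [mul_assoc]
        rw [h2, torusIntegral_const_mul]
        have h3 : ((fun _ => ρ) ∘ Fin.succ : Fin n → ℝ) = fun _ => ρ := rfl
        rw [h3, this, smul_eq_mul]
        ring
      · refine hf.comp ?_ fun y hy => (hcons x y).2 ⟨hx', hy⟩
        exact Continuous.continuousOn (by fun_prop)
      · intro y hy i
        have := hd (Fin.cons x y) ((hcons x y).2 ⟨hx', hy⟩) i.succ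
        simpa [Fin.cons_update] using this
    rw [circleIntegral.integral_congr hρ.le key]
    rw [circleIntegral.integral_const_mul,
      Complex.circleIntegral_sub_inv_smul_of_differentiable_on_off_countable
        Set.countable_empty hz0]
    · rw [hzc, smul_eq_mul]; ring
    · refine hf.comp (Continuous.continuousOn (by fun_prop)) fun x hx =>
        (hcons x _).2 ⟨hx, ball_subset_closedBall hzt⟩
    · intro x hx
      have := hd (Fin.cons x (z ∘ Fin.succ))
        ((hcons x _).2 ⟨ball_subset_closedBall hx.1, ball_subset_closedBall hzt⟩) 0
      simpa [Fin.update_cons_zero] using this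

open BoundedContinuousFunction in
/-- **Osgood's lemma**. -/
theorem analyticAt_of_separately_differentiable {ρ : ℝ} (hρ : 0 < ρ) (f : (Fin n → ℂ) → ℂ)
    (c : Fin n → ℂ) (hf : ContinuousOn f (closedBall c ρ))
    (hd : ∀ z ∈ closedBall c ρ, ∀ i,
      DifferentiableAt ℂ (fun w => f (Function.update z i w)) (z i)) :
    AnalyticAt ℂ f c := by
  have htm := continuous_torusMap c (fun _ => ρ)
  -- In the Banach algebra of bounded continuous functions of the angles, `e` holds the coordinates
  -- on the torus, `w` the Jacobian and `g` the boundary values of `f`.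
  let e : Fin n → ((Fin n → ℝ) →ᵇ ℂ) := fun i => BoundedContinuousFunction.ofNormedAddCommGroup
    (fun θ => torusMap c (fun _ => ρ) θ i) ((continuous_apply i).comp htm) (‖c‖ + ρ) (by
      intro θ
      have h1 := torusMap_mem_closedBall hρ.le (c := c) θ
      rw [mem_closedBall, dist_eq_norm] at h1
      have h2 := norm_le_pi_norm (torusMap c (fun _ => ρ) θ) i
      have h3 := norm_sub_norm_le (torusMap c (fun _ => ρ) θ) c
      linarith)
  let w : ((Fin n → ℝ) →ᵇ ℂ) := BoundedContinuousFunction.mkOfBound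
    ⟨fun θ => (∏ i : Fin n, (ρ : ℂ) * Complex.exp (θ i * Complex.I) * Complex.I), by fun_prop⟩
    (2 * ρ ^ n) (by
      intro x y
      have : ∀ x : Fin n → ℝ, ‖∏ i : Fin n, (ρ : ℂ) * Complex.exp (x i * Complex.I) * Complex.I‖
          = ρ ^ n := by
        intro x
        simp [Complex.norm_exp_ofReal_mul_I, abs_of_nonneg hρ.le]
      simp only [ContinuousMap.coe_mk]
      refine (dist_le_norm_add_norm _ _).trans ?_
      rw [this, this]; linarith)
  obtain ⟨Cf, hCf⟩ := (isCompact_closedBall c ρ).exists_bound_of_continuousOn hf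
  let g : ((Fin n → ℝ) →ᵇ ℂ) := BoundedContinuousFunction.ofNormedAddCommGroup
    (fun θ => f (torusMap c (fun _ => ρ) θ))
    (hf.comp_continuous htm fun θ => torusMap_mem_closedBall hρ.le θ) Cf
    (fun θ => hCf _ (torusMap_mem_closedBall hρ.le θ))
  have hfin : volume (Set.Icc (0 : Fin n → ℝ) fun _ => 2 * Real.pi) < ⊤ :=
    isCompact_Icc.measure_lt_top
  have : IsFiniteMeasure (volume.restrict (Set.Icc (0 : Fin n → ℝ) fun _ => 2 * Real.pi)) :=
    ⟨by simpa using hfin⟩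
  let L : ((Fin n → ℝ) →ᵇ ℂ) →ₗ[ℂ] ℂ :=
    { toFun := fun φ => ∫ θ in Set.Icc (0 : Fin n → ℝ) fun _ => 2 * Real.pi, φ θ
      map_add' := fun φ ψ => by
        simp only [BoundedContinuousFunction.coe_add, Pi.add_apply]
        exact integral_add (φ.integrable _) (ψ.integrable _)
      map_smul' := fun a φ => by
        simp only [BoundedContinuousFunction.coe_smul, RingHom.id_apply]
        exact integral_smul a _ }
  let Lc : ((Fin n → ℝ) →ᵇ ℂ) →L[ℂ] ℂ := L.mkContinuous
    (volume.real (Set.Icc (0 : Fin n → ℝ) fun _ => 2 * Real.pi)) (by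
      intro φ
      refine (norm_setIntegral_le_of_norm_le_const hfin fun θ _ => φ.norm_coe_le_norm θ).trans ?_
      rw [mul_comm])
  -- The Cauchy kernel as an algebra-valued function of `z`. It is analytic because inversion is
  -- analytic on the units of a Banach algebra, and `f` is its image under a continuous linear
  -- functional.
  let k : (Fin n → ℂ) → ((Fin n → ℝ) →ᵇ ℂ) := fun z => ∏ i, Ring.inverse (e i - algebraMap ℂ ((Fin n → ℝ) →ᵇ ℂ) (z i))
  have hunit : ∀ z ∈ ball c ρ, ∀ i, ∃ b : ((Fin n → ℝ) →ᵇ ℂ), (∀ θ, b θ = (e i θ - z i)⁻¹) ∧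
      (e i - algebraMap ℂ ((Fin n → ℝ) →ᵇ ℂ) (z i)) * b = 1 := by
    intro z hz i
    have hpos : 0 < ρ - dist z c := by rw [mem_ball] at hz; linarith
    have hne : ∀ θ, e i θ - z i ≠ 0 := by
      intro θ h
      have h1 := le_norm_torusMap_sub c z ρ θ i
      have h2 : torusMap c (fun _ => ρ) θ i - z i = 0 := h
      rw [h2, norm_zero] at h1
      linarith
    refine ⟨BoundedContinuousFunction.ofNormedAddCommGroup (fun θ => (e i θ - z i)⁻¹)
      (Continuous.inv₀ ((e i).continuous.sub continuous_const) hne) (ρ - dist z c)⁻¹ ?_,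
      fun θ => rfl, ?_⟩
    · intro θ
      rw [norm_inv]
      exact inv_anti₀ hpos (le_norm_torusMap_sub c z ρ θ i)
    · ext θ
      have : (e i - algebraMap ℂ ((Fin n → ℝ) →ᵇ ℂ) (z i)) θ = e i θ - z i := by
        simp [BoundedContinuousFunction.algebraMap_apply]
      simp only [BoundedContinuousFunction.coe_mul, Pi.mul_apply, this,
        BoundedContinuousFunction.coe_one, Pi.one_apply]
      exact mul_inv_cancel₀ (hne θ)
  have hk : AnalyticAt ℂ k c := by
    refine Finset.analyticAt_fun_prod _ fun i _ => ?_
    obtain ⟨b, -, hb⟩ := hunit c (mem_ball_self hρ) i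
    have hu : IsUnit (e i - algebraMap ℂ ((Fin n → ℝ) →ᵇ ℂ) (c i)) := IsUnit.of_mul_eq_one b hb
    have h1 : AnalyticAt ℂ (fun z : Fin n → ℂ => e i - algebraMap ℂ ((Fin n → ℝ) →ᵇ ℂ) (z i)) c := by
      refine analyticAt_const.sub ?_
      exact ((Algebra.linearMap ℂ ((Fin n → ℝ) →ᵇ ℂ)).toContinuousLinearMap.comp
        (ContinuousLinearMap.proj (R := ℂ) (φ := fun _ : Fin n => ℂ) i)).analyticAt c
    exact AnalyticAt.comp (g := Ring.inverse) (analyticOnNhd_inverse _ hu) h1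
  have hrep : ∀ z ∈ ball c ρ, ((2 * Real.pi * Complex.I) ^ n)⁻¹ * Lc (w * (k z * g)) = f z := by
    intro z hz
    have h1 := torusIntegral_cauchyKernel_mul hρ f c hf hd hz
    have h2 : Lc (w * (k z * g)) =
        torusIntegral (fun w => (∏ i, (w i - z i)⁻¹) * f w) c (fun _ => ρ) := by
      change (∫ θ in Set.Icc (0 : Fin n → ℝ) fun _ => 2 * Real.pi, (w * (k z * g)) θ) = _
      unfold torusIntegral
      congr 1
      ext θ
      have h3 : k z θ = ∏ i, (torusMap c (fun _ => ρ) θ i - z i)⁻¹ := by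
        have : k z = ∏ i, (hunit z hz i).choose := by
          refine Finset.prod_congr rfl fun i _ => ?_
          have hb := (hunit z hz i).choose_spec.2
          exact ring_inverse_eq_of_mul_eq_one hb
        rw [this]
        have h4 : ∀ s : Finset (Fin n), (∏ i ∈ s, (hunit z hz i).choose) θ
            = ∏ i ∈ s, (torusMap c (fun _ => ρ) θ i - z i)⁻¹ := by
          intro s
          induction s using Finset.induction_on with
          | empty => simp
          | insert i s his ihs =>
            rw [Finset.prod_insert his, Finset.prod_insert his, ← ihs]
            simp only [BoundedContinuousFunction.coe_mul, Pi.mul_apply]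
            rw [(hunit z hz i).choose_spec.1 θ]
            rfl
        exact h4 _
      simp only [BoundedContinuousFunction.coe_mul, Pi.mul_apply, h3, smul_eq_mul]
      rfl
    rw [h2, h1, ← mul_assoc, inv_mul_cancel₀, one_mul]
    exact pow_ne_zero _ Complex.two_pi_I_ne_zero
  have han : AnalyticAt ℂ (fun z => ((2 * Real.pi * Complex.I) ^ n)⁻¹ * Lc (w * (k z * g))) c := by
    refine analyticAt_const.mul ?_
    exact (Lc.analyticAt _).comp (analyticAt_const.mul (hk.mul analyticAt_const))
  refine han.congr ?_
  filter_upwards [ball_mem_nhds c hρ] with z hz using hrep z hz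

end Osgood

/-! ### Holomorphy of uniformly convergent series in several variables. -/

section UniformSums

open Metric

/-- Uniform convergence gives continuity, the one-variable Weierstrass theorem gives holomorphy in
each coordinate, and Osgood's lemma combines the two. -/
theorem analyticOnNhd_tsum_pi {n : ℕ} {ι : Type*} {U : Set (Fin n → ℂ)} (hU : IsOpen U)
    {F : ι → (Fin n → ℂ) → ℂ} {b : ι → ℝ} (hb : Summable b)
    (hF : ∀ i, AnalyticOnNhd ℂ (F i) U) (hle : ∀ i, ∀ z ∈ U, ‖F i z‖ ≤ b i) :
    AnalyticOnNhd ℂ (fun z => ∑' i, F i z) U := by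
  intro c hc
  obtain ⟨ρ, hρ, hsub⟩ := nhds_basis_closedBall.mem_iff.1 (hU.mem_nhds hc)
  refine analyticAt_of_separately_differentiable hρ _ c ?_ ?_
  · exact continuousOn_tsum (fun i => (hF i).continuousOn.mono hsub) hb
      fun i z hz => hle i z (hsub hz)
  · intro z hz i
    have hcont : Continuous fun w : ℂ => Function.update z i w :=
      continuous_const.update i continuous_id
    have hV : IsOpen {w : ℂ | Function.update z i w ∈ U} := hU.preimage hcont
    have hdiff : DifferentiableOn ℂ (fun w => ∑' k, F k (Function.update z i w))
        {w : ℂ | Function.update z i w ∈ U} := by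
      refine Complex.differentiableOn_tsum_of_summable_norm hb (fun k => ?_) hV
        fun k w hw => hle k _ hw
      intro w hw
      refine DifferentiableAt.differentiableWithinAt ?_
      exact DifferentiableAt.comp w (hF k _ hw).differentiableAt
        (hasFDerivAt_update z w).differentiableAt
    refine hdiff.differentiableAt (hV.mem_nhds ?_)
    simpa using hsub hz

/-- The linear identification of `ℂ × ℂ^d` with `ℂ^{d+1}`. -/
noncomputable def consCLM (d : ℕ) : ℂ × (Fin d → ℂ) →L[ℂ] (Fin (d + 1) → ℂ) :=
  ContinuousLinearMap.pi (Fin.cons (ContinuousLinearMap.fst ℂ ℂ (Fin d → ℂ))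
    fun i => (ContinuousLinearMap.proj i).comp (ContinuousLinearMap.snd ℂ ℂ (Fin d → ℂ)))

/-- The linear identification of `ℂ^{d+1}` with `ℂ × ℂ^d`. -/
noncomputable def unconsCLM (d : ℕ) : (Fin (d + 1) → ℂ) →L[ℂ] ℂ × (Fin d → ℂ) :=
  (ContinuousLinearMap.proj (R := ℂ) (φ := fun _ : Fin (d + 1) => ℂ) 0).prod
    (ContinuousLinearMap.pi fun i : Fin d => ContinuousLinearMap.proj i.succ)

theorem unconsCLM_consCLM (d : ℕ) (w : ℂ × (Fin d → ℂ)) : unconsCLM d (consCLM d w) = w := by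
  ext <;> simp [unconsCLM, consCLM]

/-- A uniformly absolutely convergent series of holomorphic functions is holomorphic. -/
theorem analyticOnNhd_tsum {d : ℕ} {ι : Type*} {U : Set (ℂ × (Fin d → ℂ))} (hU : IsOpen U)
    {F : ι → ℂ × (Fin d → ℂ) → ℂ} {b : ι → ℝ} (hb : Summable b)
    (hF : ∀ i, AnalyticOnNhd ℂ (F i) U) (hle : ∀ i, ∀ z ∈ U, ‖F i z‖ ≤ b i) :
    AnalyticOnNhd ℂ (fun z => ∑' i, F i z) U := by
  have h1 : AnalyticOnNhd ℂ (fun z => ∑' i, F i (unconsCLM d z)) (unconsCLM d ⁻¹' U) :=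
    analyticOnNhd_tsum_pi (hU.preimage (unconsCLM d).continuous) hb
      (fun i => (hF i).comp ((unconsCLM d).analyticOnNhd _) fun z hz => hz)
      fun i z hz => hle i _ hz
  have h2 : AnalyticOnNhd ℂ (fun w => ∑' i, F i (unconsCLM d (consCLM d w))) U :=
    h1.comp ((consCLM d).analyticOnNhd _) fun w hw => by
      simpa [Set.mem_preimage, unconsCLM_consCLM] using hw
  simpa only [unconsCLM_consCLM] using h2

end UniformSums

/-! ### Iterated partial derivatives and Cauchy estimates. -/

section Derivatives

open Metric

variable {d : ℕ}

/-- To prove a property of a family of iterated derivatives `∂_z^α G_a`, graded by the order of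
differentiation, it suffices to check that it is preserved by each `∂/∂z_i`. -/
theorem multiDz_induction {κ : Type*} (P : ℕ → (κ → (Fin d → ℂ) → ℂ) → Prop)
    (hP : ∀ k i G, P k G → P (k + 1) fun a => partialDz i (G a))
    (α : Fin d → ℕ) {G : κ → (Fin d → ℂ) → ℂ} (h0 : P 0 G) :
    P (len α) fun a => multiDz α (G a) := by
  have hiter : ∀ (i : Fin d) (r k : ℕ) (G : κ → (Fin d → ℂ) → ℂ), P k G →
      P (k + r) fun a => (partialDz i)^[r] (G a) := by
    intro i r
    induction r with
    | zero => intro k G h; simpa using h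
    | succ r ih =>
      intro k G h
      simp only [Function.iterate_succ', Function.comp_apply]
      exact hP _ i _ (ih k G h)
  have hlist : ∀ l : List (Fin d), P (l.map α).sum
      fun a => l.foldr (fun i g => (partialDz i)^[α i] g) (G a) := by
    intro l
    induction l with
    | nil => simpa using h0
    | cons i l ih =>
      simp only [List.map_cons, List.sum_cons, List.foldr_cons]
      rw [add_comm]
      exact hiter i (α i) _ _ ih
  have := hlist (List.finRange d)
  rwa [← Fin.sum_univ_def] at this

theorem analyticAt_partialDz (i : Fin d) {f : (Fin d → ℂ) → ℂ} {z : Fin d → ℂ}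
    (hf : AnalyticAt ℂ f z) : AnalyticAt ℂ (partialDz i f) z :=
  ((ContinuousLinearMap.apply ℂ ℂ (Pi.single i (1 : ℂ) : Fin d → ℂ)).analyticAt _).comp hf.fderiv

theorem analyticOnNhd_multiDz (α : Fin d → ℕ) {f : (Fin d → ℂ) → ℂ} {U : Set (Fin d → ℂ)}
    (hf : AnalyticOnNhd ℂ f U) : AnalyticOnNhd ℂ (multiDz α f) U :=
  multiDz_induction (κ := Unit) (fun _ G => AnalyticOnNhd ℂ (G ()) U)
    (fun _ i _ h z hz => analyticAt_partialDz i (h z hz)) α (G := fun _ => f) hf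

/-- Differentiation in `z` preserves joint holomorphy in `(ξ, z)`. -/
theorem analyticOnNhd_multiDz_param (α : Fin d → ℕ) {G : ℂ → (Fin d → ℂ) → ℂ}
    {U : Set (ℂ × (Fin d → ℂ))} (hG : AnalyticOnNhd ℂ (fun w : ℂ × (Fin d → ℂ) => G w.1 w.2) U) :
    AnalyticOnNhd ℂ (fun w : ℂ × (Fin d → ℂ) => multiDz α (G w.1) w.2) U := by
  refine multiDz_induction (κ := ℂ)
    (fun _ G => AnalyticOnNhd ℂ (fun w : ℂ × (Fin d → ℂ) => G w.1 w.2) U) ?_ α hG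
  intro _ i G h w hw
  have h1 : AnalyticAt ℂ (fun w : ℂ × (Fin d → ℂ) =>
      fderiv ℂ (fun w : ℂ × (Fin d → ℂ) => G w.1 w.2) w (0, Pi.single i 1)) w :=
    ((ContinuousLinearMap.apply ℂ ℂ
      ((0, Pi.single i (1 : ℂ)) : ℂ × (Fin d → ℂ))).analyticAt _).comp (h w hw).fderiv
  refine h1.congr ?_
  filter_upwards [(h w hw).eventually_analyticAt] with v hv
  have h2 : HasFDerivAt (fun z : Fin d → ℂ => (v.1, z)) (ContinuousLinearMap.inr ℂ ℂ (Fin d → ℂ))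
      v.2 := hasFDerivAt_prodMk_right v.1 v.2
  have h3 : HasFDerivAt (G v.1) ((fderiv ℂ (fun w : ℂ × (Fin d → ℂ) => G w.1 w.2) v).comp
      (ContinuousLinearMap.inr ℂ ℂ (Fin d → ℂ))) v.2 :=
    HasFDerivAt.comp (g := fun w : ℂ × (Fin d → ℂ) => G w.1 w.2) v.2
      hv.differentiableAt.hasFDerivAt h2
  simp only [partialDz]
  rw [h3.fderiv]
  simp

/-- Indexing the pair by `Bool` turns a relation between two functions into a property of one
family, to which `multiDz_induction` applies. -/
theorem multiDz_congr (α : Fin d → ℕ) {f g : (Fin d → ℂ) → ℂ} {z : Fin d → ℂ}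
    (h : f =ᶠ[𝓝 z] g) : multiDz α f =ᶠ[𝓝 z] multiDz α g :=
  multiDz_induction (κ := Bool) (fun _ G => G true =ᶠ[𝓝 z] G false)
    (fun _ i _ h => (h.fderiv (𝕜 := ℂ)).mono fun w hw => by simp only [partialDz, hw]) α
    (G := fun b => if b then f else g) (by simpa using h)

/-- The same device with `Option ι`: `none` stands for the sum and `some a` for its summands, so
that linearity is carried through each derivative. -/
theorem multiDz_sum {ι : Type*} (α : Fin d → ℕ) {U : Set (Fin d → ℂ)} (hU : IsOpen U)
    (s : Finset ι) (c : ι → ℂ) {f : (Fin d → ℂ) → ℂ} {g : ι → (Fin d → ℂ) → ℂ}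
    (hg : ∀ a ∈ s, AnalyticOnNhd ℂ (g a) U) (hf : ∀ z ∈ U, f z = ∑ a ∈ s, c a * g a z) :
    ∀ z ∈ U, multiDz α f z = ∑ a ∈ s, c a * multiDz α (g a) z := by
  have := multiDz_induction (κ := Option ι)
    (fun _ G => (∀ a ∈ s, AnalyticOnNhd ℂ (G (some a)) U) ∧
      ∀ z ∈ U, G none z = ∑ a ∈ s, c a * G (some a) z) ?_ α
    (G := fun a => a.elim f g) ⟨hg, hf⟩
  · exact this.2
  · rintro _ i G ⟨h1, h2⟩
    refine ⟨fun a ha z hz => analyticAt_partialDz i (h1 a ha z hz), fun z hz => ?_⟩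
    have h3 : G none =ᶠ[𝓝 z] fun z => ∑ a ∈ s, c a * G (some a) z := by
      filter_upwards [hU.mem_nhds hz] with w hw using h2 w hw
    have h4 : HasFDerivAt (fun z => ∑ a ∈ s, c a * G (some a) z)
        (∑ a ∈ s, c a • fderiv ℂ (G (some a)) z) z :=
      HasFDerivAt.fun_sum fun a ha => (h1 a ha z hz).differentiableAt.hasFDerivAt.const_mul (c a)
    simp only [partialDz]
    rw [h3.fderiv_eq, h4.fderiv]
    simp

/-- The one-variable Cauchy estimate on the complex line through `z` in direction `i`, on circles of
radius `r < ε`, followed by `r → ε`. -/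
theorem norm_partialDz_le (i : Fin d) {f : (Fin d → ℂ) → ℂ} {z : Fin d → ℂ} {ε M : ℝ} (hε : 0 < ε)
    (hf : AnalyticOnNhd ℂ f (ball z ε)) (hM : ∀ w ∈ ball z ε, ‖f w‖ ≤ M) :
    ‖partialDz i f z‖ ≤ M / ε := by
  have hline : ∀ w : ℂ, z + w • (Pi.single i (1 : ℂ) : Fin d → ℂ) ∈ ball z ε ↔ ‖w‖ < ε := by
    intro w
    have h1 : ‖(Pi.single i (1 : ℂ) : Fin d → ℂ)‖ = 1 := by
      rw [Pi.norm_single, norm_one]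
    rw [mem_ball, dist_eq_norm, add_sub_cancel_left, norm_smul, h1, mul_one]
  have hderiv : ∀ w : ℂ, ‖w‖ < ε → HasDerivAt (fun w : ℂ => f (z + w • Pi.single i (1 : ℂ)))
      (fderiv ℂ f (z + w • (Pi.single i (1 : ℂ) : Fin d → ℂ)) (Pi.single i 1)) w := by
    intro w hw
    have h1 := (hf _ ((hline w).2 hw)).differentiableAt.hasFDerivAt
    have h2 : HasDerivAt (fun w : ℂ => z + w • (Pi.single i (1 : ℂ) : Fin d → ℂ))
        (Pi.single i (1 : ℂ)) w := by
      simpa using ((hasDerivAt_id w).smul_const (Pi.single i (1 : ℂ) : Fin d → ℂ)).const_add z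
    exact h1.comp_hasDerivAt w h2
  have hM0 : 0 ≤ M := (norm_nonneg _).trans (hM z (mem_ball_self hε))
  have hle : ∀ r, 0 < r → r < ε → ‖partialDz i f z‖ ≤ M / r := by
    intro r hr hrε
    have h0 := hderiv 0 (by simpa using hε)
    simp only [zero_smul, add_zero] at h0
    have : ‖deriv (fun w : ℂ => f (z + w • (Pi.single i (1 : ℂ) : Fin d → ℂ))) 0‖ ≤ M / r := by
      refine Complex.norm_deriv_le_of_forall_mem_sphere_norm_le hr ?_ ?_
      · refine DifferentiableOn.diffContOnCl_ball (U := closedBall 0 r) ?_ subset_rfl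
        intro w hw
        rw [mem_closedBall_zero_iff] at hw
        exact (hderiv w (hw.trans_lt hrε)).differentiableAt.differentiableWithinAt
      · intro w hw
        rw [mem_sphere_zero_iff_norm] at hw
        exact hM _ ((hline w).2 (hw ▸ hrε))
    rwa [h0.deriv] at this
  have hlim : Tendsto (fun r => M / r) (𝓝[<] ε) (𝓝 (M / ε)) :=
    (tendsto_const_nhds.div tendsto_id hε.ne').mono_left nhdsWithin_le_nhds
  refine ge_of_tendsto hlim ?_
  filter_upwards [Ioo_mem_nhdsLT hε] with r hr using hle r hr.1 hr.2

/-- Cauchy's estimate for `∂_z^α f`. -/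
theorem norm_multiDz_le (α : Fin d → ℕ) {f : (Fin d → ℂ) → ℂ} {R ε M : ℝ} (hε : 0 < ε)
    (hf : AnalyticOnNhd ℂ f (ball 0 R)) (hM : ∀ w ∈ ball 0 R, ‖f w‖ ≤ M) :
    ∀ z ∈ ball 0 (R - len α * ε), ‖multiDz α f z‖ ≤ M / ε ^ len α := by
  have := multiDz_induction (κ := Unit)
    (fun k G => AnalyticOnNhd ℂ (G ()) (ball 0 R) ∧
      ∀ z ∈ ball (0 : Fin d → ℂ) (R - k * ε), ‖G () z‖ ≤ M / ε ^ k) ?_ α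
    (G := fun _ => f) ⟨hf, by simpa using hM⟩
  · exact this.2
  · rintro k i G ⟨h1, h2⟩
    refine ⟨fun z hz => analyticAt_partialDz i (h1 z hz), fun z hz => ?_⟩
    have hsub : ball z ε ⊆ ball 0 (R - k * ε) := by
      refine ball_subset_ball' ?_
      rw [mem_ball] at hz
      push_cast at hz
      linarith
    have hsub' : ball (0 : Fin d → ℂ) (R - k * ε) ⊆ ball 0 R :=
      ball_subset_ball (by nlinarith [hε, (Nat.cast_nonneg k : (0 : ℝ) ≤ k)])
    have := norm_partialDz_le i hε (h1.mono (hsub.trans hsub')) fun w hw => h2 w (hsub hw)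
    rwa [div_div, ← pow_succ] at this

/-- A form of Cauchy's estimate adapted to a pair of radii. -/
theorem norm_multiDz_le_of_lt (α : Fin d → ℕ) {L : ℕ} (hL : 0 < L) (hα : len α ≤ L)
    {f : (Fin d → ℂ) → ℂ} {R R' M : ℝ} (hR : R' < R)
    (hf : AnalyticOnNhd ℂ f (ball 0 R)) (hM : ∀ w ∈ ball 0 R, ‖f w‖ ≤ M) :
    ∀ z ∈ ball 0 R', ‖multiDz α f z‖ ≤ M * (L / (R - R')) ^ len α := by
  intro z hz
  have hL' : (0 : ℝ) < L := by exact_mod_cast hL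
  have hε : 0 < (R - R') / L := div_pos (by linarith) hL'
  have h := norm_multiDz_le α hε hf hM z (ball_subset_ball ?_ hz)
  · rwa [div_eq_mul_inv, ← inv_pow, inv_div] at h
  · have : (len α : ℝ) * ((R - R') / L) ≤ L * ((R - R') / L) :=
      mul_le_mul_of_nonneg_right (by exact_mod_cast hα) hε.le
    rw [mul_div_cancel₀ _ hL'.ne'] at this
    linarith

theorem multiDz_zero (f : (Fin d → ℂ) → ℂ) : multiDz 0 f = f := by
  unfold multiDz
  induction List.finRange d with
  | nil => rfl
  | cons i l _ => simp

theorem multiDz_of_len_eq_zero {α : Fin d → ℕ} (h : len α = 0) (f : (Fin d → ℂ) → ℂ) :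
    multiDz α f = f := by
  have : α = 0 := by
    ext i
    exact (Finset.sum_eq_zero_iff.1 h) i (Finset.mem_univ i)
  rw [this, multiDz_zero]

/-- Termwise differentiation of a uniformly absolutely convergent series. -/
theorem hasSum_multiDz (α : Fin d → ℕ) {ι : Type*} {R : ℝ} {g : ι → (Fin d → ℂ) → ℂ} {b : ι → ℝ}
    (hb : Summable b) (hg : ∀ a, AnalyticOnNhd ℂ (g a) (ball 0 R))
    (hle : ∀ a, ∀ z ∈ ball 0 R, ‖g a z‖ ≤ b a) {z : Fin d → ℂ} (hz : z ∈ ball 0 R) :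
    HasSum (fun a => multiDz α (g a) z) (multiDz α (fun z => ∑' a, g a z) z) := by
  obtain ⟨R', hzR', hR'⟩ := exists_between (mem_ball.1 hz)
  have hu := tendstoUniformlyOn_tsum hb hle
  have hf : AnalyticOnNhd ℂ (fun z => ∑' a, g a z) (ball 0 R) :=
    analyticOnNhd_tsum_pi isOpen_ball hb hg hle
  set K : ℝ := ((len α + 1 : ℕ) / (R - R')) ^ len α with hK
  have hK0 : 0 < K := by
    have : 0 < R - R' := by linarith
    positivity
  rw [HasSum, SummationFilter.unconditional_filter, Metric.tendsto_nhds]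
  intro ε hε
  -- `K` is the Cauchy constant between the radii `R` and `R'`, so a remainder at most `ε / (2 * K)`
  -- on the large ball has derivative at most `ε / 2` at `z`.
  have := Metric.tendstoUniformlyOn_iff.1 hu (ε / (2 * K)) (by positivity)
  filter_upwards [this] with s hs
  have hdiff : AnalyticOnNhd ℂ (fun z => ∑' a, g a z - ∑ a ∈ s, g a z) (ball 0 R) :=
    hf.sub (Finset.analyticOnNhd_fun_sum _ fun a _ => hg a)
  have h1 := norm_multiDz_le_of_lt α (L := len α + 1) (by omega) (by omega) hR' hdiff
    (M := ε / (2 * K)) (fun w hw => by simpa [dist_eq_norm] using (hs w hw).le) z hzR'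
  have h2 := multiDz_sum α (isOpen_ball (x := (0 : Fin d → ℂ)) (ε := R)) (Finset.insertNone s)
    (fun a : Option ι => a.elim 1 fun _ => -1) (f := fun z => ∑' a, g a z - ∑ a ∈ s, g a z)
    (g := fun a : Option ι => a.elim (fun z => ∑' a, g a z) g)
    (by rintro (_ | a) _; exacts [hf, hg a])
    (by intro z _; simp [Finset.sum_insertNone, sub_eq_add_neg]) z hz
  simp only [Finset.sum_insertNone, Option.elim, one_mul, neg_mul, Finset.sum_neg_distrib,
    ← sub_eq_add_neg] at h2
  rw [dist_comm, dist_eq_norm, ← h2]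
  refine h1.trans_lt ?_
  rw [← hK, div_mul_eq_mul_div, div_lt_iff₀ (by positivity)]
  nlinarith

end Derivatives

/-! ### From the Newton polygon to vanishing and bounds of Taylor coefficients. -/

open Metric

variable {d : ℕ}

theorem polydisc_eq_ball {R : ℝ} (hR : 0 < R) : polydisc d R = ball 0 R := by
  ext z
  rw [mem_ball_zero_iff, pi_norm_lt_iff hR]
  rfl

/-- The coefficients `c p i` of the Taylor expansions in `t` of the coefficients of the equation, the
right-hand side `F` and the formal solution `X`, with uniform bounds on a ball around the origin of
`ℂ^d` and with the vanishing properties encoded in the Newton polygon. -/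
structure NormalizedEquation (q δ : ℝ) (m m₀ : ℕ) (c : ℕ × (Fin d → ℕ) → ℕ → (Fin d → ℂ) → ℂ)
    (F X : ℕ → (Fin d → ℂ) → ℂ) (ρ A B : ℝ) : Prop where
  one_lt_q : 1 < q
  delta_pos : 0 < δ
  lt_m : m₀ < m
  rho_pos : 0 < ρ
  one_le_A : 1 ≤ A
  one_le_B : 1 ≤ B
  analytic_c : ∀ p ∈ indexSet d m δ, ∀ i, AnalyticOnNhd ℂ (c p i) (ball 0 ρ)
  norm_c_le : ∀ p ∈ indexSet d m δ, ∀ i, ∀ z ∈ ball (0 : Fin d → ℂ) ρ, ‖c p i z‖ ≤ A * B ^ i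
  c_eq_zero : ∀ p ∈ indexSet d m δ, ∀ i, i + m₀ < p.1 → ∀ z ∈ ball (0 : Fin d → ℂ) ρ, c p i z = 0
  c_eq_zero_of_len_pos : ∀ p ∈ indexSet d m δ, 0 < len p.2 → ∀ i, i = 0 ∨ i + m₀ ≤ p.1 →
    ∀ z ∈ ball (0 : Fin d → ℂ) ρ, c p i z = 0
  analytic_F : ∀ n, AnalyticOnNhd ℂ (F n) (ball 0 ρ)
  norm_F_le : ∀ n, ∀ z ∈ ball (0 : Fin d → ℂ) ρ, ‖F n z‖ ≤ A * B ^ n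
  analytic_X : ∀ n, AnalyticOnNhd ℂ (X n) (ball 0 ρ)
  equation : ∀ n, ∀ z ∈ ball (0 : Fin d → ℂ) ρ,
    ∑ p ∈ indexSet d m δ, ∑ kl ∈ Finset.HasAntidiagonal.antidiagonal n,
      c p kl.1 z * (((q : ℂ) ^ kl.2) ^ p.1 * multiDz p.2 (X kl.2) z) = F n z
  lower_ne : c (m₀, 0) 0 0 ≠ 0
  upper_ne : c (m, 0) (m - m₀) 0 ≠ 0

theorem analyticOnNhd_iteratedDeriv_fst {f : ℂ × (Fin d → ℂ) → ℂ} {U : Set (ℂ × (Fin d → ℂ))}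
    (hf : AnalyticOnNhd ℂ f U) (k : ℕ) :
    AnalyticOnNhd ℂ (fun w : ℂ × (Fin d → ℂ) => iteratedDeriv k (fun t => f (t, w.2)) w.1) U := by
  induction k with
  | zero => simpa using hf
  | succ k ih =>
    intro w hw
    have h1 : AnalyticAt ℂ (fun w : ℂ × (Fin d → ℂ) => fderiv ℂ (fun w : ℂ × (Fin d → ℂ) =>
        iteratedDeriv k (fun t => f (t, w.2)) w.1) w (1, 0)) w :=
      ((ContinuousLinearMap.apply ℂ ℂ ((1, 0) : ℂ × (Fin d → ℂ))).analyticAt _).comp (ih w hw).fderiv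
    refine h1.congr ?_
    filter_upwards [(ih w hw).eventually_analyticAt] with v hv
    have h2 : HasDerivAt (fun t : ℂ => (t, v.2)) ((1, 0) : ℂ × (Fin d → ℂ)) v.1 :=
      (hasDerivAt_id v.1).prodMk (hasDerivAt_const v.1 v.2)
    have h3 := HasFDerivAt.comp_hasDerivAt (l := fun w : ℂ × (Fin d → ℂ) =>
      iteratedDeriv k (fun t => f (t, w.2)) w.1) v.1 hv.differentiableAt.hasFDerivAt h2
    rw [iteratedDeriv_succ]
    exact h3.deriv.symm

theorem analyticOnNhd_tCoeff {f : ℂ × (Fin d → ℂ) → ℂ} {r : ℝ}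
    (hf : AnalyticOnNhd ℂ f (closedBall 0 r)) (k : ℕ) :
    AnalyticOnNhd ℂ (tCoeff f k) (ball 0 r) := by
  intro z hz
  have h1 := analyticOnNhd_iteratedDeriv_fst hf k (0, z) (by
    rw [mem_ball_zero_iff] at hz
    rw [mem_closedBall_zero_iff, Prod.norm_def, norm_zero]
    exact max_le ((norm_nonneg z).trans hz.le) hz.le)
  have h2 : AnalyticAt ℂ (fun z : Fin d → ℂ => ((0 : ℂ), z)) z :=
    analyticAt_const.prod analyticAt_id
  exact (AnalyticAt.comp h1 h2).div analyticAt_const (by exact_mod_cast k.factorial_ne_zero)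

theorem norm_tCoeff_le {f : ℂ × (Fin d → ℂ) → ℂ} {r M : ℝ} (hr : 0 < r)
    (hf : AnalyticOnNhd ℂ f (closedBall 0 r)) (hM : ∀ w ∈ closedBall 0 r, ‖f w‖ ≤ M) (k : ℕ)
    {z : Fin d → ℂ} (hz : z ∈ ball 0 r) : ‖tCoeff f k z‖ ≤ M * (1 / r) ^ k := by
  have hmem : ∀ t : ℂ, ‖t‖ ≤ r → ((t, z) : ℂ × (Fin d → ℂ)) ∈ closedBall 0 r := by
    intro t ht
    rw [mem_ball_zero_iff] at hz
    rw [mem_closedBall_zero_iff, Prod.norm_def]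
    exact max_le ht hz.le
  have hd : DiffContOnCl ℂ (fun t => f (t, z)) (ball 0 r) := by
    refine DifferentiableOn.diffContOnCl_ball (U := closedBall 0 r) ?_ subset_rfl
    intro t ht
    rw [mem_closedBall_zero_iff] at ht
    refine DifferentiableAt.differentiableWithinAt ?_
    exact DifferentiableAt.comp t (hf _ (hmem t ht)).differentiableAt (by fun_prop)
  have := Complex.norm_iteratedDeriv_le_of_forall_mem_sphere_norm_le k hr hd
    (C := M) fun t ht => hM _ (hmem t (mem_sphere_zero_iff_norm.1 ht).le)
  have hk : (0 : ℝ) < k.factorial := by exact_mod_cast k.factorial_pos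
  rw [tCoeff, norm_div, Complex.norm_natCast, div_le_iff₀ hk]
  refine this.trans (le_of_eq ?_)
  rw [one_div, inv_pow]
  ring

theorem qShift_iterate (q : ℝ) (j : ℕ) (Y : ℕ → (Fin d → ℂ) → ℂ) (n : ℕ) (z : Fin d → ℂ) :
    (qShift q)^[j] Y n z = ((q : ℂ) ^ n) ^ j * Y n z := by
  induction j with
  | zero => simp
  | succ j ih =>
    rw [Function.iterate_succ', Function.comp_apply, qShift, ih, pow_succ]
    ring

theorem exists_ordT_eq_of_not_eventually {f : ℂ × (Fin d → ℂ) → ℂ} {k : ℕ}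
    (h : ¬ ∀ᶠ z in 𝓝 (0 : Fin d → ℂ), tCoeff f k z = 0) : ∃ k' ≤ k, ordT f = k' := by
  have h1 : ordT f ≤ k := by
    refine iInf₂_le k fun h' => h (h'.mono fun z hz => ?_)
    rw [tCoeff, hz, zero_div]
  have h2 : ordT f ≠ ⊤ := (h1.trans_lt (ENat.natCast_lt_top k)).ne
  lift ordT f to ℕ using h2 with k' hk'
  exact ⟨k', by exact_mod_cast h1, rfl⟩

theorem mem_newtonPolygon {δ : ℝ} {m : ℕ} {a : ℕ × (Fin d → ℕ) → ℂ × (Fin d → ℂ) → ℂ}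
    {p : ℕ × (Fin d → ℕ)} (hp : p ∈ indexSet d m δ) {k : ℕ} (hk : ordT (a p) = k) :
    ((p.1 : ℝ), (k : ℝ)) ∈ newtonPolygon δ m a := by
  refine subset_convexHull ℝ _ ?_
  simp only [Set.mem_iUnion]
  exact ⟨p, hp, k, hk, le_refl _, le_refl _⟩

theorem le_add_of_condA1 {δ : ℝ} {m m₀ : ℕ} {a : ℕ × (Fin d → ℕ) → ℂ × (Fin d → ℂ) → ℂ}
    (hA1 : CondA1 δ m m₀ a) {p : ℕ × (Fin d → ℕ)} (hp : p ∈ indexSet d m δ) {k : ℕ}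
    (hk : ordT (a p) = k) : p.1 ≤ k + m₀ := by
  have h1 := mem_newtonPolygon hp hk
  rw [hA1] at h1
  have h2 := (le_max_right _ _).trans h1.2
  simp only at h2
  have : (p.1 : ℝ) ≤ k + m₀ := by linarith
  exact_mod_cast this

theorem lt_of_condA2 {δ : ℝ} {m m₀ : ℕ} {a : ℕ × (Fin d → ℕ) → ℂ × (Fin d → ℂ) → ℂ}
    (hA1 : CondA1 δ m m₀ a) (hA2 : CondA2 δ m a) {p : ℕ × (Fin d → ℕ)} (hp : p ∈ indexSet d m δ)
    (hlen : 0 < len p.2) {k : ℕ} (hk : ordT (a p) = k) : 0 < k ∧ p.1 < k + m₀ := by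
  have h1 := hA2 p hp hlen k hk
  rw [mem_interior_iff_mem_nhds, Metric.mem_nhds_iff] at h1
  obtain ⟨ε, hε, hsub⟩ := h1
  -- An interior point may be moved down while staying in the polygon, which makes both inequalities
  -- of (A₁) strict.
  have h2 : ((p.1 : ℝ), (k : ℝ) - ε / 2) ∈ newtonPolygon δ m a := by
    refine hsub ?_
    rw [mem_ball, Prod.dist_eq, dist_self, Real.dist_eq, sub_sub_cancel_left, abs_neg,
      abs_of_pos (by linarith)]
    exact max_lt hε (by linarith)
  rw [hA1] at h2
  have h3 := max_le_iff.1 h2.2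
  simp only at h3
  have h4 : (0 : ℝ) < k := by linarith [h3.1]
  have h5 : (p.1 : ℝ) < k + m₀ := by linarith [h3.2]
  exact ⟨by exact_mod_cast h4, by exact_mod_cast h5⟩

/-- `ordT` and `IsFormalSolution` only speak of germs at `z = 0`; the identity theorem spreads their
identities over a fixed ball. -/
theorem eqOn_zero_ball {f : (Fin d → ℂ) → ℂ} {r : ℝ} (hr : 0 < r)
    (hf : AnalyticOnNhd ℂ f (ball 0 r)) (h : ∀ᶠ z in 𝓝 (0 : Fin d → ℂ), f z = 0) :
    ∀ z ∈ ball (0 : Fin d → ℂ) r, f z = 0 :=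
  hf.eqOn_zero_of_preconnected_of_eventuallyEq_zero (convex_ball 0 r).isPreconnected
    (mem_ball_self hr) h

theorem mem_indexSet_zero {m : ℕ} {δ : ℝ} (hδ : 0 < δ) {j : ℕ} (hj : j ≤ m) :
    ((j, 0) : ℕ × (Fin d → ℕ)) ∈ indexSet d m δ := by
  rw [mem_indexSet hδ]
  simpa [len] using hj

/-- Finitely many coefficients share one closed ball of holomorphy, on which they are bounded by
compactness; Cauchy's estimate in `t` then bounds all Taylor coefficients. (A₁) and (A₂) enter the
rest of the proof only through the vanishing recorded here. -/
theorem exists_normalizedEquation {q δ : ℝ} (hq : 1 < q) (hδ : 0 < δ) {m : ℕ}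
    {a : ℕ × (Fin d → ℕ) → ℂ × (Fin d → ℂ) → ℂ} {F : ℂ × (Fin d → ℂ) → ℂ}
    (ha : ∀ p ∈ indexSet d m δ, AnalyticAt ℂ (a p) (0, 0)) (hF : AnalyticAt ℂ F (0, 0))
    {R : ℝ} (hR : 0 < R) {X : ℕ → (Fin d → ℂ) → ℂ}
    (hX : ∀ n, AnalyticOnNhd ℂ (X n) (polydisc d R)) (hsol : IsFormalSolution q δ m a F X)
    {m₀ : ℕ} (hm₀ : m₀ < m) (hA1 : CondA1 δ m m₀ a) (hA2 : CondA2 δ m a)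
    (ha₀ : a (m₀, 0) (0, 0) ≠ 0) (hb₀ : bFun m₀ a m (0, 0) ≠ 0) :
    ∃ ρ A B : ℝ, ρ ≤ R ∧
      NormalizedEquation q δ m m₀ (fun p i => tCoeff (a p) i) (tCoeff F) X ρ A B := by
  have hsmall : ∀ f : ℂ × (Fin d → ℂ) → ℂ, AnalyticAt ℂ f (0, 0) →
      ∀ᶠ r in 𝓝[>] (0 : ℝ), AnalyticOnNhd ℂ f (closedBall 0 r) := by
    intro f hf
    obtain ⟨ε, hε, hsub⟩ := Metric.mem_nhds_iff.1 hf.eventually_analyticAt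
    filter_upwards [Ioo_mem_nhdsGT hε] with r hr w hw
    exact hsub (closedBall_subset_ball hr.2 hw)
  have hall : ∀ᶠ r in 𝓝[>] (0 : ℝ), ∀ p ∈ indexSet d m δ, AnalyticOnNhd ℂ (a p) (closedBall 0 r) :=
    (Finset.eventually_all _).2 fun p hp => hsmall _ (ha p hp)
  obtain ⟨r, ⟨hra, hrF⟩, hr⟩ := ((hall.and (hsmall F hF)).and (Ioo_mem_nhdsGT hR)).exists
  have hr0 : 0 < r := hr.1
  have hrR : r ≤ R := hr.2.le
  have hbound : ∀ f : ℂ × (Fin d → ℂ) → ℂ, AnalyticOnNhd ℂ f (closedBall 0 r) →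
      ∃ M, ∀ w ∈ closedBall (0 : ℂ × (Fin d → ℂ)) r, ‖f w‖ ≤ M := fun f hf =>
    (isCompact_closedBall _ r).exists_bound_of_continuousOn hf.continuousOn
  obtain ⟨MF, hMF⟩ := hbound F hrF
  have hMa : ∃ M, ∀ p ∈ indexSet d m δ, ∀ w ∈ closedBall (0 : ℂ × (Fin d → ℂ)) r, ‖a p w‖ ≤ M := by
    choose! M hM using fun p (hp : p ∈ indexSet d m δ) => hbound (a p) (hra p hp)
    obtain ⟨M', hM'⟩ := ((indexSet d m δ).image M).exists_le
    exact ⟨M', fun p hp w hw => (hM p hp w hw).trans (hM' _ (Finset.mem_image_of_mem M hp))⟩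
  obtain ⟨Ma, hMa⟩ := hMa
  set A : ℝ := max 1 (max MF Ma)
  set B : ℝ := max 1 (1 / r)
  have hA : 1 ≤ A := le_max_left _ _
  have hB : 1 ≤ B := le_max_left _ _
  have hcoeff : ∀ (f : ℂ × (Fin d → ℂ) → ℂ) (M : ℝ), M ≤ A → AnalyticOnNhd ℂ f (closedBall 0 r) →
      (∀ w ∈ closedBall (0 : ℂ × (Fin d → ℂ)) r, ‖f w‖ ≤ M) → ∀ (k : ℕ) (z : Fin d → ℂ),
      z ∈ ball 0 r → ‖tCoeff f k z‖ ≤ A * B ^ k := by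
    intro f M hMA hf hM k z hz
    refine (norm_tCoeff_le hr0 hf hM k hz).trans ?_
    gcongr
    exact le_max_right _ _
  have hXr : ∀ n, AnalyticOnNhd ℂ (X n) (ball 0 r) := fun n => (hX n).mono (by
    rw [polydisc_eq_ball hR]; exact ball_subset_ball hrR)
  have hzero : ∀ p ∈ indexSet d m δ, ∀ k : ℕ, (¬ ∃ k' : ℕ, k' ≤ k ∧ ordT (a p) = k') →
      ∀ z ∈ ball (0 : Fin d → ℂ) r, tCoeff (a p) k z = 0 := by
    intro p hp k hk
    refine eqOn_zero_ball hr0 (analyticOnNhd_tCoeff (hra p hp) k) ?_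
    by_contra h
    exact hk (exists_ordT_eq_of_not_eventually h)
  refine ⟨r, A, B, hrR, hq, hδ, hm₀, hr0, hA, hB,
    fun p hp i => analyticOnNhd_tCoeff (hra p hp) i, fun p hp i z hz => hcoeff (a p) Ma
      ((le_max_right _ _).trans (le_max_right _ _)) (hra p hp) (hMa p hp) i z hz, ?_, ?_,
    fun n => analyticOnNhd_tCoeff hrF n, fun n z hz => hcoeff F MF
      ((le_max_left _ _).trans (le_max_right _ _)) hrF hMF n z hz, hXr, ?_, ?_, ?_⟩
  · intro p hp i hi
    refine hzero p hp i ?_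
    rintro ⟨k', hk', h⟩
    have := le_add_of_condA1 hA1 hp h
    omega
  · intro p hp hlen i hi
    refine hzero p hp i ?_
    rintro ⟨k', hk', h⟩
    have := lt_of_condA2 hA1 hA2 hp hlen h
    omega
  · intro n z hz
    have h1 : AnalyticOnNhd ℂ (fun z => ∑ p ∈ indexSet d m δ, ∑ kl ∈ Finset.HasAntidiagonal.antidiagonal n,
        tCoeff (a p) kl.1 z * (((q : ℂ) ^ kl.2) ^ p.1 * multiDz p.2 (X kl.2) z) - tCoeff F n z)
        (ball 0 r) := by
      refine AnalyticOnNhd.sub ?_ (analyticOnNhd_tCoeff hrF n)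
      refine Finset.analyticOnNhd_fun_sum _ fun p hp => Finset.analyticOnNhd_fun_sum _ fun kl _ => ?_
      exact (analyticOnNhd_tCoeff (hra p hp) _).mul
        (analyticOnNhd_const.mul (analyticOnNhd_multiDz _ (hXr _)))
    refine sub_eq_zero.1 (eqOn_zero_ball hr0 h1 ?_ z hz)
    filter_upwards [hsol n] with w hw
    rw [← hw, sub_eq_zero]
    simp only [mulSeries, qShift_iterate]
  · simpa [tCoeff] using ha₀
  · simpa [bFun] using hb₀

/-! ### Arithmetic of the exponent `n(n-1)/2`. -/

section Triangular

/-- The exponent `n(n-1)/2`. -/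
def tri (n : ℕ) : ℕ := n * (n - 1) / 2

theorem two_mul_tri (n : ℕ) : 2 * tri n = n * (n - 1) :=
  Nat.mul_div_cancel' (Nat.even_mul_pred_self n).two_dvd

theorem two_mul_tri_cast (n : ℕ) : 2 * (tri n : ℝ) = n * (n - 1) := by
  rcases n with _ | n
  · simp [tri]
  · have := two_mul_tri (n + 1)
    rw [Nat.add_sub_cancel] at this
    have h : ((2 * tri (n + 1) : ℕ) : ℝ) = ((n + 1) * n : ℕ) := by rw [this]
    push_cast at h ⊢
    linarith

theorem tri_add (a b : ℕ) : tri (a + b) = tri a + tri b + a * b := by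
  have h1 := two_mul_tri_cast (a + b)
  have h2 := two_mul_tri_cast a
  have h3 := two_mul_tri_cast b
  push_cast at h1
  have : ((tri (a + b) : ℕ) : ℝ) = ((tri a + tri b + a * b : ℕ) : ℝ) := by
    push_cast
    linarith
  exact_mod_cast this

end Triangular

/-! ### Cauchy estimates on a shrinking sequence of balls. -/

section Shrinking

/-- A decreasing sequence of radii, from `2 R` to `R`. -/
noncomputable def radius (R κ : ℝ) (n : ℕ) : ℝ := R * (1 + κ⁻¹ ^ n)

theorem radius_zero (R κ : ℝ) : radius R κ 0 = 2 * R := by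
  simp only [radius, pow_zero]; ring

theorem radius_anti {R κ : ℝ} (hR : 0 < R) (hκ : 1 < κ) : Antitone (radius R κ) := by
  intro l n hln
  have h1 : κ⁻¹ ^ n ≤ κ⁻¹ ^ l :=
    pow_le_pow_of_le_one (by positivity) (inv_le_one_of_one_le₀ hκ.le) hln
  unfold radius
  gcongr

theorem lt_radius {R κ : ℝ} (hR : 0 < R) (hκ : 1 < κ) (n : ℕ) : R < radius R κ n := by
  have : 0 < κ⁻¹ ^ n := by positivity
  unfold radius
  nlinarith

theorem exists_pow_eq {q : ℝ} (hq : 1 < q) {L : ℕ} (hL : 0 < L) : ∃ κ : ℝ, 1 < κ ∧ κ ^ L = q := by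
  have hq0 : 0 ≤ q := by linarith
  refine ⟨q ^ ((L : ℝ)⁻¹), Real.one_lt_rpow hq (by positivity), ?_⟩
  rw [← Real.rpow_natCast, ← Real.rpow_mul hq0, inv_mul_cancel₀ (by positivity), Real.rpow_one]

/-- Cauchy's estimate along the sequence `radius R κ`, with a loss of at most a geometric factor. -/
theorem exists_norm_multiDz_le_radius {R κ q : ℝ} (hR : 0 < R) (hκ : 1 < κ) {L : ℕ} (hL : 0 < L)
    (hκL : κ ^ L = q) :
    ∃ C : ℝ, 1 ≤ C ∧ ∀ α : Fin d → ℕ, len α ≤ L → ∀ l n : ℕ, l < n →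
      ∀ (f : (Fin d → ℂ) → ℂ) (M : ℝ), AnalyticOnNhd ℂ f (ball 0 (radius R κ l)) →
      (∀ z ∈ ball (0 : Fin d → ℂ) (radius R κ l), ‖f z‖ ≤ M) →
      ∀ z ∈ ball (0 : Fin d → ℂ) (radius R κ n), ‖multiDz α f z‖ ≤ C * q ^ n * M := by
  set T : ℝ := max 1 (L / (R * (κ - 1)))
  have hT : 1 ≤ T := le_max_left _ _
  have hκ0 : 0 < κ := by linarith
  refine ⟨T ^ L, one_le_pow₀ hT, fun α hα l n hln f M hf hM z hz => ?_⟩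
  obtain ⟨n, rfl⟩ : ∃ k, n = k + 1 := ⟨n - 1, by omega⟩
  have hM0 : 0 ≤ M := (norm_nonneg _).trans (hM 0 (mem_ball_self (hR.trans (lt_radius hR hκ l))))
  -- The gap is at least the last step of the sequence, of order `κ⁻¹ ^ (n + 1)`; at most `L`
  -- derivatives therefore cost at most a constant times `κ ^ (L * (n + 1)) = q ^ (n + 1)`.
  have hgap : R * (κ - 1) * κ⁻¹ ^ (n + 1) ≤ radius R κ l - radius R κ (n + 1) := by
    have h1 := radius_anti hR hκ (show l ≤ n by omega)
    have h2 : radius R κ n - radius R κ (n + 1) = R * (κ - 1) * κ⁻¹ ^ (n + 1) := by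
      simp only [radius, pow_succ]
      field_simp
      ring
    linarith
  have hpos : 0 < R * (κ - 1) * κ⁻¹ ^ (n + 1) := by
    have : 0 < κ - 1 := by linarith
    positivity
  have h1 := norm_multiDz_le_of_lt α hL hα (by linarith) hf hM z hz
  refine h1.trans ?_
  rw [mul_comm]
  refine mul_le_mul_of_nonneg_right ?_ hM0
  have h2 : (L : ℝ) / (radius R κ l - radius R κ (n + 1)) ≤ T * κ ^ (n + 1) := by
    calc (L : ℝ) / (radius R κ l - radius R κ (n + 1))
        ≤ L / (R * (κ - 1) * κ⁻¹ ^ (n + 1)) := by gcongr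
      _ = L / (R * (κ - 1)) * κ ^ (n + 1) := by
          rw [inv_pow, ← div_div, div_inv_eq_mul]
      _ ≤ T * κ ^ (n + 1) := by
          gcongr
          exact le_max_right _ _
  have h3 : 1 ≤ T * κ ^ (n + 1) := one_le_mul_of_one_le_of_one_le hT (one_le_pow₀ hκ.le)
  calc (↑L / (radius R κ l - radius R κ (n + 1))) ^ len α
      ≤ (T * κ ^ (n + 1)) ^ len α := by
        refine pow_le_pow_left₀ (div_nonneg (Nat.cast_nonneg _) (by linarith)) h2 _
    _ ≤ (T * κ ^ (n + 1)) ^ L := pow_le_pow_right₀ h3 hα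
    _ = T ^ L * q ^ (n + 1) := by
        rw [mul_pow, ← pow_mul, mul_comm (n + 1) L, pow_mul, hκL]

end Shrinking

/-! ### The recurrence for the coefficients of the `q`-Borel transform. -/

theorem multiDz_const_mul (α : Fin d → ℕ) {U : Set (Fin d → ℂ)} (hU : IsOpen U) (b : ℂ)
    {g : (Fin d → ℂ) → ℂ} (hg : AnalyticOnNhd ℂ g U) :
    ∀ z ∈ U, multiDz α (fun z => b * g z) z = b * multiDz α g z := by
  intro z hz
  simpa using multiDz_sum α hU (Finset.univ : Finset Unit) (fun _ => b) (f := fun z => b * g z)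
    (g := fun _ => g) (fun _ _ => hg) (by simp) z hz

/-- The coefficients of the `q`-Borel transform. -/
noncomputable def borelCoeff (q : ℝ) (X : ℕ → (Fin d → ℂ) → ℂ) (n : ℕ) (z : Fin d → ℂ) : ℂ :=
  X n z / (q : ℂ) ^ tri n

/-- The coefficients of the equation satisfied by the `q`-Borel transform. -/
noncomputable def borelEqCoeff (q : ℝ) (m₀ : ℕ) (c : ℕ × (Fin d → ℕ) → ℕ → (Fin d → ℂ) → ℂ)
    (p : ℕ × (Fin d → ℕ)) (i : ℕ) (z : Fin d → ℂ) : ℂ :=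
  c p i z / (q : ℂ) ^ tri p.1 / (q : ℂ) ^ (tri (i + m₀ - p.1) + p.1 * (i + m₀ - p.1))

namespace NormalizedEquation

variable {q δ : ℝ} {m m₀ : ℕ} {c : ℕ × (Fin d → ℕ) → ℕ → (Fin d → ℂ) → ℂ}
  {F X : ℕ → (Fin d → ℂ) → ℂ} {ρ A B : ℝ}

theorem q_pos (h : NormalizedEquation q δ m m₀ c F X ρ A B) : 0 < q :=
  zero_lt_one.trans h.one_lt_q

theorem qC_ne (h : NormalizedEquation q δ m m₀ c F X ρ A B) : (q : ℂ) ≠ 0 := by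
  exact_mod_cast h.q_pos.ne'

theorem analytic_borelCoeff (h : NormalizedEquation q δ m m₀ c F X ρ A B) (n : ℕ) :
    AnalyticOnNhd ℂ (borelCoeff q X n) (ball 0 ρ) := fun z hz =>
  (h.analytic_X n z hz).div analyticAt_const (pow_ne_zero _ h.qC_ne)

theorem analytic_borelEqCoeff (h : NormalizedEquation q δ m m₀ c F X ρ A B)
    {p : ℕ × (Fin d → ℕ)} (hp : p ∈ indexSet d m δ) (i : ℕ) :
    AnalyticOnNhd ℂ (borelEqCoeff q m₀ c p i) (ball 0 ρ) := fun z hz =>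
  ((h.analytic_c p hp i z hz).div analyticAt_const (pow_ne_zero _ h.qC_ne)).div analyticAt_const
    (pow_ne_zero _ h.qC_ne)

theorem borelEqCoeff_eq_zero (h : NormalizedEquation q δ m m₀ c F X ρ A B)
    {p : ℕ × (Fin d → ℕ)} (hp : p ∈ indexSet d m δ) {i : ℕ} (hi : i + m₀ < p.1) {z : Fin d → ℂ}
    (hz : z ∈ ball 0 ρ) : borelEqCoeff q m₀ c p i z = 0 := by
  simp [borelEqCoeff, h.c_eq_zero p hp i hi z hz]

theorem borelEqCoeff_eq_zero_of_len_pos (h : NormalizedEquation q δ m m₀ c F X ρ A B)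
    {p : ℕ × (Fin d → ℕ)} (hp : p ∈ indexSet d m δ) (hlen : 0 < len p.2) {i : ℕ}
    (hi : i = 0 ∨ i + m₀ ≤ p.1) {z : Fin d → ℂ} (hz : z ∈ ball 0 ρ) :
    borelEqCoeff q m₀ c p i z = 0 := by
  simp [borelEqCoeff, h.c_eq_zero_of_len_pos p hp hlen i hi z hz]

theorem norm_borelEqCoeff_le (h : NormalizedEquation q δ m m₀ c F X ρ A B)
    {p : ℕ × (Fin d → ℕ)} (hp : p ∈ indexSet d m δ) (i : ℕ) {z : Fin d → ℂ} (hz : z ∈ ball 0 ρ) :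
    ‖borelEqCoeff q m₀ c p i z‖ ≤
      A * B ^ i / q ^ (tri (i + m₀ - p.1) + p.1 * (i + m₀ - p.1)) := by
  have hq := h.q_pos
  rw [borelEqCoeff, norm_div, norm_div, norm_pow, norm_pow, Complex.norm_of_nonneg hq.le]
  have h1 : ‖c p i z‖ / q ^ tri p.1 ≤ ‖c p i z‖ :=
    div_le_self (norm_nonneg _) (one_le_pow₀ h.one_lt_q.le)
  gcongr
  exact h1.trans (h.norm_c_le p hp i z hz)

theorem norm_borelEqCoeff_le' (h : NormalizedEquation q δ m m₀ c F X ρ A B)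
    {p : ℕ × (Fin d → ℕ)} (hp : p ∈ indexSet d m δ) (i : ℕ) {z : Fin d → ℂ} (hz : z ∈ ball 0 ρ) :
    ‖borelEqCoeff q m₀ c p i z‖ ≤ A * B ^ i := by
  have := h.one_le_A
  have := h.one_le_B
  exact (h.norm_borelEqCoeff_le hp i hz).trans
    (div_le_self (by positivity) (one_le_pow₀ h.one_lt_q.le))

/-- The recurrence relation satisfied by the coefficients of the `q`-Borel transform. -/
theorem borel_recurrence (h : NormalizedEquation q δ m m₀ c F X ρ A B) (n : ℕ) {z : Fin d → ℂ}
    (hz : z ∈ ball 0 ρ) :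
    ∑ p ∈ indexSet d m δ, ∑ kl ∈ Finset.HasAntidiagonal.antidiagonal n,
      borelEqCoeff q m₀ c p kl.1 z / ((q : ℂ) ^ (kl.1 + m₀ - p.1)) ^ kl.2 *
        multiDz p.2 (borelCoeff q X kl.2) z = F n z / (q : ℂ) ^ tri (n + m₀) := by
  have hq := h.qC_ne
  rw [← h.equation n z hz, Finset.sum_div]
  refine Finset.sum_congr rfl fun p hp => ?_
  rw [Finset.sum_div]
  refine Finset.sum_congr rfl fun kl hkl => ?_
  obtain ⟨k, l⟩ := kl
  rw [Finset.HasAntidiagonal.mem_antidiagonal] at hkl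
  simp only at hkl ⊢
  subst hkl
  have hD : multiDz p.2 (borelCoeff q X l) z = ((q : ℂ) ^ tri l)⁻¹ * multiDz p.2 (X l) z := by
    rw [← multiDz_const_mul p.2 isOpen_ball _ (h.analytic_X l) z hz]
    congr 1
    ext w
    rw [borelCoeff, div_eq_inv_mul]
  rw [hD]
  -- When `k + m₀ < p.1` the truncated subtraction `k + m₀ - p.1` is meaningless, but the
  -- coefficient vanishes by (A₁).
  rcases lt_or_ge (k + m₀) p.1 with hk | hk
  · rw [h.borelEqCoeff_eq_zero hp hk hz, h.c_eq_zero p hp k hk z hz]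
    simp
  · obtain ⟨s, hs⟩ := Nat.exists_eq_add_of_le hk
    have hs' : k + m₀ - p.1 = s := by omega
    have hN : k + l + m₀ = l + p.1 + s := by omega
    -- Splitting `tri (l + p.1 + s)` isolates `tri l`, which turns `X l` into the Borel coefficient,
    -- the product `l * p.1`, which cancels the `q`-shift, and `l * s`, which is the dilation `ξ ↦ ξ
    -- / q ^ s`.
    rw [borelEqCoeff, hs', hN, tri_add, tri_add]
    field_simp
    ring

end NormalizedEquation

/-! ### Convergence of the `q`-Borel transform near the origin. -/

theorem sum_half_pow_succ_le (n : ℕ) : ∑ k ∈ Finset.range n, (1 / 2 : ℝ) ^ (k + 1) ≤ 1 := by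
  have : ∑ k ∈ Finset.range n, (1 / 2 : ℝ) ^ (k + 1) = 1 - (1 / 2) ^ n := by
    induction n with
    | zero => simp
    | succ n ih => rw [Finset.sum_range_succ, ih]; ring
  rw [this]
  linarith [show (0 : ℝ) ≤ (1 / 2) ^ n by positivity]

theorem exists_len_le (d m : ℕ) (δ : ℝ) :
    ∃ L : ℕ, 0 < L ∧ ∀ p ∈ indexSet d m δ, len p.2 ≤ L := by
  obtain ⟨L, hL⟩ := ((indexSet d m δ).image fun p => len p.2).exists_le
  exact ⟨L + 1, by omega, fun p hp => (hL _ (Finset.mem_image_of_mem _ hp)).trans (by omega)⟩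

namespace NormalizedEquation

variable {q δ : ℝ} {m m₀ : ℕ} {c : ℕ × (Fin d → ℕ) → ℕ → (Fin d → ℂ) → ℂ}
  {F X : ℕ → (Fin d → ℂ) → ℂ} {ρ A B : ℝ}

theorem fst_le (h : NormalizedEquation q δ m m₀ c F X ρ A B) {p : ℕ × (Fin d → ℕ)}
    (hp : p ∈ indexSet d m δ) : p.1 ≤ m := by
  rw [mem_indexSet h.delta_pos] at hp
  have : 0 ≤ δ * (len p.2 : ℝ) := mul_nonneg h.delta_pos.le (Nat.cast_nonneg _)
  have : (p.1 : ℝ) ≤ m := by linarith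
  exact_mod_cast this

/-- This is where `δ > 0` counts: a term with derivatives in `z` has one shift to spare, which later
pays the factor `q ^ n` of Cauchy's estimate. -/
theorem fst_lt (h : NormalizedEquation q δ m m₀ c F X ρ A B) {p : ℕ × (Fin d → ℕ)}
    (hp : p ∈ indexSet d m δ) (hlen : 0 < len p.2) : p.1 < m := by
  rw [mem_indexSet h.delta_pos] at hp
  have : 0 < δ * (len p.2 : ℝ) := mul_pos h.delta_pos (by exact_mod_cast hlen)
  have : (p.1 : ℝ) < m := by linarith
  exact_mod_cast this

/-- The factor of `u_n` in the `n`-th recurrence relation. -/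
theorem exists_le_norm_leading (h : NormalizedEquation q δ m m₀ c F X ρ A B) :
    ∃ (ρ₁ ε : ℝ) (n₀ : ℕ), 0 < ρ₁ ∧ ρ₁ ≤ ρ ∧ 0 < ε ∧ ∀ n ≥ n₀, ∀ z ∈ ball (0 : Fin d → ℂ) ρ₁,
      ε ≤ ‖∑ p ∈ indexSet d m δ,
        borelEqCoeff q m₀ c p 0 z / ((q : ℂ) ^ (0 + m₀ - p.1)) ^ n‖ := by
  have hq := h.q_pos
  have hA := h.one_le_A
  set g : (Fin d → ℂ) → ℂ := borelEqCoeff q m₀ c (m₀, 0) 0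
  have hmem : ((m₀, 0) : ℕ × (Fin d → ℕ)) ∈ indexSet d m δ :=
    mem_indexSet_zero h.delta_pos h.lt_m.le
  have hg0 : 0 < ‖g 0‖ := by
    rw [norm_pos_iff]
    exact div_ne_zero (div_ne_zero h.lower_ne (pow_ne_zero _ h.qC_ne)) (pow_ne_zero _ h.qC_ne)
  have hgc : ContinuousAt (fun z => ‖g z‖) 0 :=
    ((h.analytic_borelEqCoeff hmem 0) 0 (mem_ball_self h.rho_pos)).continuousAt.norm
  obtain ⟨r, hr, hsub⟩ := Metric.mem_nhds_iff.1
    (hgc.eventually (lt_mem_nhds (show ‖g 0‖ / 2 < ‖g 0‖ by linarith)))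
  obtain ⟨n₀, hn₀⟩ := pow_unbounded_of_one_lt
    ((indexSet d m δ).card * A / (‖g 0‖ / 4)) h.one_lt_q
  refine ⟨min r ρ, ‖g 0‖ / 4, n₀, lt_min hr h.rho_pos, min_le_right _ _, by linarith, ?_⟩
  intro n hn z hz
  have hzr : z ∈ ball (0 : Fin d → ℂ) r := ball_subset_ball (min_le_left _ _) hz
  have hzρ : z ∈ ball (0 : Fin d → ℂ) ρ := ball_subset_ball (min_le_right _ _) hz
  have h1 : ‖g 0‖ / 2 < ‖g z‖ := hsub hzr
  rw [← Finset.add_sum_erase _ _ hmem]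
  have hrest : ‖∑ p ∈ (indexSet d m δ).erase (m₀, 0),
      borelEqCoeff q m₀ c p 0 z / ((q : ℂ) ^ (0 + m₀ - p.1)) ^ n‖ ≤ ‖g 0‖ / 4 := by
    have hterm : ∀ p ∈ (indexSet d m δ).erase (m₀, 0),
        ‖borelEqCoeff q m₀ c p 0 z / ((q : ℂ) ^ (0 + m₀ - p.1)) ^ n‖ ≤ A / q ^ n := by
      intro p hp
      have hpI := Finset.mem_of_mem_erase hp
      have hne := Finset.ne_of_mem_erase hp
      -- For `i = 0`, (A₂) removes the indices with `|α| > 0` and (A₁) those with `j > m₀`; the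
      -- remaining ones have `j < m₀` and are divided by at least `q ^ n`.
      have hzero : borelEqCoeff q m₀ c p 0 z = 0 ∨ p.1 < m₀ := by
        by_cases hlen : 0 < len p.2
        · exact Or.inl (h.borelEqCoeff_eq_zero_of_len_pos hpI hlen (Or.inl rfl) hzρ)
        · rcases lt_trichotomy p.1 m₀ with h2 | h2 | h2
          · exact Or.inr h2
          · refine absurd (Prod.ext h2 ?_) hne
            ext i
            exact (Finset.sum_eq_zero_iff.1 (Nat.eq_zero_of_not_pos hlen)) i (Finset.mem_univ i)
          · exact Or.inl (h.borelEqCoeff_eq_zero hpI (by omega) hzρ)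
      rcases hzero with h2 | h2
      · rw [h2, zero_div, norm_zero]
        positivity
      · rw [norm_div, norm_pow, norm_pow, Complex.norm_of_nonneg hq.le]
        have h3 := h.norm_borelEqCoeff_le' hpI 0 hzρ
        rw [pow_zero, mul_one] at h3
        have h4 : q ^ n ≤ (q ^ (0 + m₀ - p.1)) ^ n :=
          pow_le_pow_left₀ hq.le (le_self_pow₀ h.one_lt_q.le (by omega)) n
        gcongr
    refine (norm_sum_le_of_le _ hterm).trans ?_
    rw [Finset.sum_const, nsmul_eq_mul, mul_div_assoc', div_le_iff₀ (by positivity)]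
    have h2 : q ^ n₀ ≤ q ^ n := pow_le_pow_right₀ h.one_lt_q.le hn
    rw [div_lt_iff₀ (by linarith)] at hn₀
    have h3 : (((indexSet d m δ).erase (m₀, 0)).card : ℝ) ≤ (indexSet d m δ).card := by
      exact_mod_cast Finset.card_le_card (Finset.erase_subset _ _)
    nlinarith
  have hmain : borelEqCoeff q m₀ c (m₀, 0) 0 z / ((q : ℂ) ^ (0 + m₀ - (m₀, (0 : Fin d → ℕ)).1)) ^ n
      = g z := by simp [g]
  rw [hmain]
  have := norm_sub_le_norm_add (g z) (∑ p ∈ (indexSet d m δ).erase (m₀, 0),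
      borelEqCoeff q m₀ c p 0 z / ((q : ℂ) ^ (0 + m₀ - p.1)) ^ n)
  linarith

/-- Convergence of the `q`-Borel transform: its coefficients grow at most geometrically. -/
theorem exists_norm_borelCoeff_le (h : NormalizedEquation q δ m m₀ c F X ρ A B) :
    ∃ ρ₁ K η : ℝ, 0 < ρ₁ ∧ ρ₁ ≤ ρ ∧ 0 < K ∧ 0 < η ∧
      ∀ n, ∀ z ∈ ball (0 : Fin d → ℂ) ρ₁, ‖borelCoeff q X n z‖ ≤ K * η ^ n := by
  obtain ⟨ρ₂, ε, n₀, hρ₂, hρ₂ρ, hε, hlead⟩ := h.exists_le_norm_leading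
  obtain ⟨L, hL, hlenL⟩ := exists_len_le d m δ
  obtain ⟨κ, hκ, hκL⟩ := exists_pow_eq h.one_lt_q hL
  have hq := h.q_pos
  have hA := h.one_le_A
  have hB := h.one_le_B
  set R : ℝ := ρ₂ / 4 with hRdef
  have hR : 0 < R := by positivity
  obtain ⟨C, hC, hder⟩ := exists_norm_multiDz_le_radius (d := d) hR hκ hL hκL
  have hrad : ∀ n, radius R κ n ≤ ρ₂ / 2 := fun n => by
    have := radius_anti hR hκ (Nat.zero_le n)
    rw [radius_zero] at this
    linarith
  have hballρ₂ : ∀ n, ball (0 : Fin d → ℂ) (radius R κ n) ⊆ ball 0 ρ₂ := fun n =>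
    ball_subset_ball ((hrad n).trans (by linarith))
  have hballρ : ∀ n, ball (0 : Fin d → ℂ) (radius R κ n) ⊆ ball 0 ρ := fun n =>
    (hballρ₂ n).trans (ball_subset_ball hρ₂ρ)
  have hinit : ∃ K₀ : ℝ, ∀ n < n₀, ∀ z ∈ closedBall (0 : Fin d → ℂ) (ρ₂ / 2),
      ‖borelCoeff q X n z‖ ≤ K₀ := by
    have : ∀ n, ∃ M, ∀ z ∈ closedBall (0 : Fin d → ℂ) (ρ₂ / 2), ‖borelCoeff q X n z‖ ≤ M :=
      fun n => (isCompact_closedBall _ _).exists_bound_of_continuousOn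
        ((h.analytic_borelCoeff n).continuousOn.mono (closedBall_subset_ball (by linarith)))
    choose M hM using this
    obtain ⟨K₀, hK₀⟩ := ((Finset.range n₀).image M).exists_le
    exact ⟨K₀, fun n hn z hz => (hM n z hz).trans
      (hK₀ _ (Finset.mem_image_of_mem M (Finset.mem_range.2 hn)))⟩
  obtain ⟨K₀, hK₀⟩ := hinit
  set N : ℝ := ((indexSet d m δ).card : ℝ)
  set T : ℝ := max 1 (2 * (N * A * C) / ε)
  have hT : 1 ≤ T := le_max_left _ _
  have hTε : 2 * (N * A * C) ≤ T * ε := by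
    rw [← div_le_iff₀ hε]
    exact le_max_right _ _
  set K : ℝ := max 1 (max K₀ (2 * A / ε))
  have hK : 1 ≤ K := le_max_left _ _
  have hKK₀ : K₀ ≤ K := (le_max_left _ _).trans (le_max_right _ _)
  have hKε : 2 * A ≤ K * ε := by
    rw [← div_le_iff₀ hε]
    exact (le_max_right _ _).trans (le_max_right _ _)
  -- In `η`, the factor `B` absorbs the growth of the coefficients, `q` the net loss from
  -- derivatives, `2` provides a convergent geometric sum, and `T` makes the earlier terms
  -- contribute at most half of the bound. The other half is left to the right-hand side, through
  -- `K`.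
  set η : ℝ := 2 * B * q * T with hη
  have hBq : 1 ≤ B * q := one_le_mul_of_one_le_of_one_le hB h.one_lt_q.le
  have hη1 : 1 ≤ η := by
    have : 1 ≤ B * q * T := one_le_mul_of_one_le_of_one_le hBq hT
    rw [hη]; linarith
  have hBη : B ≤ η := by
    have h1 : 1 ≤ q * T := one_le_mul_of_one_le_of_one_le h.one_lt_q.le hT
    rw [hη]; nlinarith
  refine ⟨R, K, η, hR, by linarith, by linarith, by linarith, ?_⟩
  suffices hmain : ∀ n, ∀ z ∈ ball (0 : Fin d → ℂ) (radius R κ n),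
      ‖borelCoeff q X n z‖ ≤ K * η ^ n from fun n z hz =>
    hmain n z (ball_subset_ball (lt_radius hR hκ n).le hz)
  intro n
  induction n using Nat.strong_induction_on with
  | _ n ih =>
  intro z hz
  rcases lt_or_ge n n₀ with hn | hn
  · have h1 := hK₀ n hn z (ball_subset_closedBall (ball_subset_ball (hrad n) hz))
    have h2 : 1 ≤ η ^ n := one_le_pow₀ hη1
    nlinarith
  have hzρ := hballρ n hz
  have hrec := h.borel_recurrence n hzρ
  simp only [Finset.Nat.sum_antidiagonal_eq_sum_range_succ_mk] at hrec
  simp only [Finset.sum_range_succ', Nat.sub_zero] at hrec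
  rw [Finset.sum_add_distrib] at hrec
  have hlast : ∑ p ∈ indexSet d m δ, borelEqCoeff q m₀ c p 0 z / ((q : ℂ) ^ (0 + m₀ - p.1)) ^ n *
      multiDz p.2 (borelCoeff q X n) z = (∑ p ∈ indexSet d m δ,
        borelEqCoeff q m₀ c p 0 z / ((q : ℂ) ^ (0 + m₀ - p.1)) ^ n) * borelCoeff q X n z := by
    rw [Finset.sum_mul]
    refine Finset.sum_congr rfl fun p hp => ?_
    by_cases hlen : 0 < len p.2
    · rw [h.borelEqCoeff_eq_zero_of_len_pos hp hlen (Or.inl rfl) hzρ]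
      simp
    · rw [multiDz_of_len_eq_zero (Nat.eq_zero_of_not_pos hlen)]
  rw [hlast] at hrec
  have hsum : ‖∑ p ∈ indexSet d m δ, ∑ k ∈ Finset.range n,
      borelEqCoeff q m₀ c p (k + 1) z / ((q : ℂ) ^ (k + 1 + m₀ - p.1)) ^ (n - (k + 1)) *
        multiDz p.2 (borelCoeff q X (n - (k + 1))) z‖ ≤ ε / 2 * (K * η ^ n) := by
    have hterm : ∀ p ∈ indexSet d m δ, ∀ k ∈ Finset.range n,
        ‖borelEqCoeff q m₀ c p (k + 1) z / ((q : ℂ) ^ (k + 1 + m₀ - p.1)) ^ (n - (k + 1)) *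
        multiDz p.2 (borelCoeff q X (n - (k + 1))) z‖
          ≤ A * C * K * η ^ n / T * (1 / 2) ^ (k + 1) := by
      intro p hp k hk
      rw [Finset.mem_range] at hk
      set l := n - (k + 1) with hl
      have hln : l < n := by omega
      have hbase : A * B ^ (k + 1) * (C * q ^ (k + 1) * (K * η ^ l)) ≤
          A * C * K * η ^ n / T * (1 / 2) ^ (k + 1) := by
        have h1 : η ^ n = η ^ l * (2 * B * q) ^ (k + 1) * T ^ (k + 1) := by
          rw [show n = l + (k + 1) by omega, pow_add, hη, mul_pow (2 * B * q) T]
          ring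
        have h2 : T ≤ T ^ (k + 1) := le_self_pow₀ hT (by omega)
        have h3 : (2 * B * q) ^ (k + 1) * (1 / 2) ^ (k + 1) = B ^ (k + 1) * q ^ (k + 1) := by
          rw [← mul_pow, ← mul_pow]; congr 1; ring
        rw [div_mul_eq_mul_div, le_div_iff₀ (by linarith), h1]
        calc A * B ^ (k + 1) * (C * q ^ (k + 1) * (K * η ^ l)) * T
            = A * C * K * η ^ l * (B ^ (k + 1) * q ^ (k + 1)) * T := by ring
          _ ≤ A * C * K * η ^ l * (B ^ (k + 1) * q ^ (k + 1)) * T ^ (k + 1) := by gcongr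
          _ = _ := by rw [← h3]; ring
      refine le_trans ?_ hbase
      rw [norm_mul, norm_div, norm_pow, norm_pow, Complex.norm_of_nonneg hq.le]
      have hg := h.norm_borelEqCoeff_le' hp (k + 1) hzρ
      by_cases hlen : 0 < len p.2
      · rcases le_or_gt (k + 1 + m₀) p.1 with hs | hs
        · rw [h.borelEqCoeff_eq_zero_of_len_pos hp hlen (Or.inr hs) hzρ]
          rw [norm_zero, zero_div, zero_mul]
          positivity
        -- The loss `q ^ n` meets a denominator at least `q ^ l`, because the dilation exponent is
        -- positive here; only `q ^ (k + 1)` survives.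
        · have hD := hder p.2 (hlenL p hp) l n hln (borelCoeff q X l) (K * η ^ l)
            ((h.analytic_borelCoeff l).mono (hballρ l)) (ih l hln) z hz
          have h4 : q ^ l ≤ (q ^ (k + 1 + m₀ - p.1)) ^ l :=
            pow_le_pow_left₀ hq.le (le_self_pow₀ h.one_lt_q.le (by omega)) l
          have h5 : q ^ n = q ^ l * q ^ (k + 1) := by
            rw [← pow_add]; congr 1; omega
          calc ‖borelEqCoeff q m₀ c p (k + 1) z‖ / (q ^ (k + 1 + m₀ - p.1)) ^ l *
              ‖multiDz p.2 (borelCoeff q X l) z‖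
              ≤ A * B ^ (k + 1) / q ^ l * (C * q ^ n * (K * η ^ l)) := by gcongr
            _ = A * B ^ (k + 1) * (C * q ^ (k + 1) * (K * η ^ l)) := by
              rw [h5]; field_simp
      · rw [multiDz_of_len_eq_zero (Nat.eq_zero_of_not_pos hlen)]
        have hD := ih l hln z (ball_subset_ball (radius_anti hR hκ hln.le) hz)
        have h4 : 1 ≤ (q ^ (k + 1 + m₀ - p.1)) ^ l :=
          one_le_pow₀ (one_le_pow₀ h.one_lt_q.le)
        have h5 : 1 ≤ C * q ^ (k + 1) :=
          one_le_mul_of_one_le_of_one_le hC (one_le_pow₀ h.one_lt_q.le)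
        have h6 : 0 ≤ K * η ^ l := by positivity
        calc ‖borelEqCoeff q m₀ c p (k + 1) z‖ / (q ^ (k + 1 + m₀ - p.1)) ^ l *
              ‖borelCoeff q X l z‖
              ≤ A * B ^ (k + 1) * (K * η ^ l) := by
                refine mul_le_mul ?_ hD (norm_nonneg _) (by positivity)
                exact (div_le_self (norm_nonneg _) h4).trans hg
            _ ≤ A * B ^ (k + 1) * (C * q ^ (k + 1) * (K * η ^ l)) := by
              refine mul_le_mul_of_nonneg_left ?_ (by positivity)
              nlinarith
    have h1 : ∀ p ∈ indexSet d m δ, ‖∑ k ∈ Finset.range n,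
        borelEqCoeff q m₀ c p (k + 1) z / ((q : ℂ) ^ (k + 1 + m₀ - p.1)) ^ (n - (k + 1)) *
        multiDz p.2 (borelCoeff q X (n - (k + 1))) z‖ ≤ A * C * K * η ^ n / T := by
      intro p hp
      refine (norm_sum_le_of_le _ (hterm p hp)).trans ?_
      rw [← Finset.mul_sum]
      exact mul_le_of_le_one_right (by positivity) (sum_half_pow_succ_le n)
    refine (norm_sum_le_of_le _ h1).trans ?_
    rw [Finset.sum_const, nsmul_eq_mul, mul_div_assoc', div_le_iff₀ (by linarith)]
    have h2 : 0 ≤ K * η ^ n := by positivity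
    change N * _ ≤ _
    nlinarith
  have hF : ‖F n z / (q : ℂ) ^ tri (n + m₀)‖ ≤ ε / 2 * (K * η ^ n) := by
    rw [norm_div, norm_pow, Complex.norm_of_nonneg hq.le]
    have h1 := h.norm_F_le n z hzρ
    have h2 : B ^ n ≤ η ^ n := pow_le_pow_left₀ (by linarith) hBη n
    calc ‖F n z‖ / q ^ tri (n + m₀) ≤ ‖F n z‖ :=
          div_le_self (norm_nonneg _) (one_le_pow₀ h.one_lt_q.le)
      _ ≤ A * B ^ n := h1
      _ ≤ A * η ^ n := by gcongr
      _ ≤ ε / 2 * (K * η ^ n) := by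
        have : 0 ≤ η ^ n := by positivity
        nlinarith
  have hfin : ‖(∑ p ∈ indexSet d m δ, borelEqCoeff q m₀ c p 0 z /
      ((q : ℂ) ^ (0 + m₀ - p.1)) ^ n) * borelCoeff q X n z‖ ≤ ε * (K * η ^ n) := by
    rw [eq_sub_of_add_eq' hrec]
    refine (norm_sub_le _ _).trans ?_
    linarith
  rw [norm_mul] at hfin
  have h1 := hlead n hn z (hballρ₂ n hz)
  have h2 := mul_le_mul_of_nonneg_right h1 (norm_nonneg (borelCoeff q X n z))
  exact le_of_mul_le_mul_left (h2.trans hfin) hε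

end NormalizedEquation

/-! ### The functional equation of the `q`-Borel transform. -/

/-- The `q`-Borel transform, as a function of `z` depending on the parameter `ξ`. -/
noncomputable def borelSum (q : ℝ) (X : ℕ → (Fin d → ℂ) → ℂ) (ξ : ℂ) (z : Fin d → ℂ) : ℂ :=
  ∑' k : ℕ, borelCoeff q X k z * ξ ^ k

/-- The `q`-Borel transform (of order `m₀`) of the right-hand side of the equation. -/
noncomputable def borelRhs (q : ℝ) (m₀ : ℕ) (F : ℕ → (Fin d → ℂ) → ℂ) (ξ : ℂ) (z : Fin d → ℂ) : ℂ :=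
  ∑' n : ℕ, F n z / (q : ℂ) ^ tri (n + m₀) * ξ ^ n

/-- The terms of the equation for the `q`-Borel transform `W` involving some `W(ξ / q^s, z)` with
`s ≥ 1`. -/
noncomputable def perturbationTerm (q : ℝ) (m₀ : ℕ) (c : ℕ × (Fin d → ℕ) → ℕ → (Fin d → ℂ) → ℂ)
    (W : ℂ → (Fin d → ℂ) → ℂ) (p : ℕ × (Fin d → ℕ)) (i : ℕ) (ξ : ℂ) (z : Fin d → ℂ) : ℂ :=
  if i + m₀ ≤ p.1 then 0 else
    borelEqCoeff q m₀ c p i z * ξ ^ i * multiDz p.2 (W (ξ / (q : ℂ) ^ (i + m₀ - p.1))) z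

/-- The part of the equation for the `q`-Borel transform `W` involving the `W(ξ / q^s, z)` with
`s ≥ 1`. -/
noncomputable def perturbation (q δ : ℝ) (m m₀ : ℕ)
    (c : ℕ × (Fin d → ℕ) → ℕ → (Fin d → ℂ) → ℂ)
    (W : ℂ → (Fin d → ℂ) → ℂ) (ξ : ℂ) (z : Fin d → ℂ) : ℂ :=
  ∑ p ∈ indexSet d m δ, ∑' i : ℕ, perturbationTerm q m₀ c W p i ξ z

/-- The characteristic polynomial in terms of the Taylor coefficients. -/
noncomputable def mainPoly (q : ℝ) (m m₀ : ℕ) (c : ℕ × (Fin d → ℕ) → ℕ → (Fin d → ℂ) → ℂ)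
    (ξ : ℂ) (z : Fin d → ℂ) : ℂ :=
  ∑ j ∈ Finset.Icc m₀ m, c (j, 0) (j - m₀) z / (q : ℂ) ^ tri j * ξ ^ (j - m₀)

theorem mainPoly_tCoeff (q : ℝ) {m m₀ : ℕ} (hm₀ : m₀ < m)
    (a : ℕ × (Fin d → ℕ) → ℂ × (Fin d → ℂ) → ℂ) (ξ : ℂ) (z : Fin d → ℂ) :
    mainPoly q m m₀ (fun p i => tCoeff (a p) i) ξ z = charPoly q m m₀ a ξ z := by
  rw [mainPoly, charPoly, ← Finset.Ioc_insert_left hm₀.le,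
    Finset.sum_insert Finset.left_notMem_Ioc, add_comm]
  congr 1
  · refine Finset.sum_congr rfl fun j _ => ?_
    simp [bFun, tri]
  · simp [tCoeff, tri]

namespace NormalizedEquation

variable {q δ : ℝ} {m m₀ : ℕ} {c : ℕ × (Fin d → ℕ) → ℕ → (Fin d → ℂ) → ℂ}
  {F X : ℕ → (Fin d → ℂ) → ℂ} {ρ A B : ℝ}

theorem norm_borelCoeff_mul_pow_le {ρ₁ K η r : ℝ} (hK : 0 < K) (hη : 0 < η) (hrη : r * η ≤ 1 / 2)
    (hu : ∀ n, ∀ z ∈ ball (0 : Fin d → ℂ) ρ₁, ‖borelCoeff q X n z‖ ≤ K * η ^ n) {ξ : ℂ}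
    (hξ : ‖ξ‖ ≤ r) (n : ℕ) {z : Fin d → ℂ} (hz : z ∈ ball 0 ρ₁) :
    ‖borelCoeff q X n z * ξ ^ n‖ ≤ K * (1 / 2) ^ n := by
  rw [norm_mul, norm_pow]
  calc ‖borelCoeff q X n z‖ * ‖ξ‖ ^ n ≤ K * η ^ n * r ^ n := by
        have := hu n z hz
        gcongr
    _ = K * (r * η) ^ n := by rw [mul_pow]; ring
    _ ≤ K * (1 / 2) ^ n := by
        have : 0 ≤ r := (norm_nonneg _).trans hξ
        gcongr

theorem summable_half (K : ℝ) : Summable fun n : ℕ => K * (1 / 2 : ℝ) ^ n :=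
  summable_geometric_two.mul_left K

theorem analyticOnNhd_borelSum (h : NormalizedEquation q δ m m₀ c F X ρ A B) {ρ₁ K η r : ℝ}
    (hρ₁ : ρ₁ ≤ ρ) (hK : 0 < K) (hη : 0 < η) (hrη : r * η ≤ 1 / 2)
    (hu : ∀ n, ∀ z ∈ ball (0 : Fin d → ℂ) ρ₁, ‖borelCoeff q X n z‖ ≤ K * η ^ n) :
    AnalyticOnNhd ℂ (fun w : ℂ × (Fin d → ℂ) => borelSum q X w.1 w.2)
      (ball (0 : ℂ) r ×ˢ ball 0 ρ₁) := by
  refine analyticOnNhd_tsum (isOpen_ball.prod isOpen_ball) (summable_half K) ?_ ?_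
  · rintro n w ⟨-, hw⟩
    exact ((h.analytic_borelCoeff n _ (ball_subset_ball hρ₁ hw)).comp analyticAt_snd).mul
      (analyticAt_fst.pow n)
  · rintro n w ⟨hw1, hw2⟩
    exact norm_borelCoeff_mul_pow_le hK hη hrη hu (mem_ball_zero_iff.1 hw1).le n hw2

theorem norm_borelSum_le {ρ₁ K η r : ℝ} (hK : 0 < K) (hη : 0 < η) (hrη : r * η ≤ 1 / 2)
    (hu : ∀ n, ∀ z ∈ ball (0 : Fin d → ℂ) ρ₁, ‖borelCoeff q X n z‖ ≤ K * η ^ n) {ξ : ℂ}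
    (hξ : ‖ξ‖ ≤ r) {z : Fin d → ℂ} (hz : z ∈ ball 0 ρ₁) : ‖borelSum q X ξ z‖ ≤ 2 * K := by
  have := tsum_of_norm_bounded ((hasSum_geometric_two).mul_left K)
    fun n => norm_borelCoeff_mul_pow_le hK hη hrη hu hξ n hz
  rw [borelSum]
  linarith

/-- These are the terms without dilation, `i = j - m₀`, which (A₂) confines to `α = 0`. -/
theorem sum_main_eq_mainPoly (hδ : 0 < δ) (z : Fin d → ℂ) (ξ v : ℂ) :
    ∑ p ∈ indexSet d m δ, (if m₀ ≤ p.1 ∧ len p.2 = 0 then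
      borelEqCoeff q m₀ c p (p.1 - m₀) z * ξ ^ (p.1 - m₀) * v else 0)
      = mainPoly q m m₀ c ξ z * v := by
  rw [mainPoly, Finset.sum_mul, ← Finset.sum_filter]
  refine Finset.sum_bij' (fun p _ => p.1) (fun j _ => (j, 0)) ?_ ?_ ?_ ?_ ?_
  · rintro ⟨j, α⟩ hp
    simp only [Finset.mem_filter, mem_indexSet hδ] at hp
    rw [hp.2.2] at hp
    simp only [Nat.cast_zero, mul_zero, add_zero, Nat.cast_le] at hp
    exact Finset.mem_Icc.2 ⟨hp.2.1, hp.1⟩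
  · intro j hj
    rw [Finset.mem_Icc] at hj
    exact Finset.mem_filter.2 ⟨mem_indexSet_zero hδ hj.2, hj.1, by simp [len]⟩
  · rintro ⟨j, α⟩ hp
    have h0 := (Finset.mem_filter.1 hp).2.2
    have : α = 0 := by
      ext i
      exact (Finset.sum_eq_zero_iff.1 h0) i (Finset.mem_univ i)
    rw [this]
  · intro j hj
    rfl
  · rintro ⟨j, α⟩ hp
    have h0 := (Finset.mem_filter.1 hp).2
    have hα : α = 0 := by
      ext i
      exact (Finset.sum_eq_zero_iff.1 h0.2) i (Finset.mem_univ i)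
    have hj : m₀ ≤ j := h0.1
    have hs : j - m₀ + m₀ - j = 0 := by omega
    simp [borelEqCoeff, hα, hs, tri]

/-- The `q`-difference-differential equation satisfied by the `q`-Borel transform near `ξ = 0`. -/
theorem borelSum_equation (h : NormalizedEquation q δ m m₀ c F X ρ A B) {ρ₁ K η r : ℝ}
    (hρ₁ : ρ₁ ≤ ρ) (hK : 0 < K) (hη : 0 < η) (hrη : r * η ≤ 1 / 2) (hrB : r * B ≤ 1 / 2)
    (hu : ∀ n, ∀ z ∈ ball (0 : Fin d → ℂ) ρ₁, ‖borelCoeff q X n z‖ ≤ K * η ^ n) {ξ : ℂ}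
    (hξ : ‖ξ‖ ≤ r) {z : Fin d → ℂ} (hz : z ∈ ball 0 ρ₁) :
    mainPoly q m m₀ c ξ z * borelSum q X ξ z + perturbation q δ m m₀ c (borelSum q X) ξ z
      = borelRhs q m₀ F ξ z := by
  have hq := h.q_pos
  have hA := h.one_le_A
  have hB := h.one_le_B
  have hr : 0 ≤ r := (norm_nonneg _).trans hξ
  have hzρ : z ∈ ball (0 : Fin d → ℂ) ρ := ball_subset_ball hρ₁ hz
  have hqs : ∀ s : ℕ, ‖ξ / (q : ℂ) ^ s‖ ≤ ‖ξ‖ := fun s => by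
    rw [norm_div, norm_pow, Complex.norm_of_nonneg hq.le]
    exact div_le_self (norm_nonneg _) (one_le_pow₀ h.one_lt_q.le)
  have hDsum : ∀ (α : Fin d → ℕ) (ζ : ℂ), ‖ζ‖ ≤ r →
      HasSum (fun l => ζ ^ l * multiDz α (borelCoeff q X l) z) (multiDz α (borelSum q X ζ) z) := by
    intro α ζ hζ
    have h1 := hasSum_multiDz α (summable_half K)
      (g := fun l z => borelCoeff q X l z * ζ ^ l) (R := ρ₁)
      (fun l w hw => (h.analytic_borelCoeff l _ (ball_subset_ball hρ₁ hw)).mul analyticAt_const)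
      (fun l w hw => norm_borelCoeff_mul_pow_le hK hη hrη hu hζ l hw) hz
    have h2 : ∀ l, multiDz α (fun z => borelCoeff q X l z * ζ ^ l) z
        = ζ ^ l * multiDz α (borelCoeff q X l) z := by
      intro l
      rw [← multiDz_const_mul α isOpen_ball (ζ ^ l) (h.analytic_borelCoeff l) z hzρ]
      simp only [mul_comm]
    simp only [h2] at h1
    exact h1
  have hDbound : ∀ α : Fin d → ℕ, ∃ M : ℝ, 0 ≤ M ∧
      ∀ l, ‖multiDz α (borelCoeff q X l) z‖ ≤ M * η ^ l := by
    intro α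
    obtain ⟨R', hzR', hR'⟩ := exists_between (mem_ball.1 hz)
    refine ⟨K * ((len α + 1 : ℕ) / (ρ₁ - R')) ^ len α, ?_, fun l => ?_⟩
    · have : 0 < ρ₁ - R' := by linarith
      positivity
    · have := norm_multiDz_le_of_lt α (L := len α + 1) (by omega) (by omega) hR'
        ((h.analytic_borelCoeff l).mono (ball_subset_ball hρ₁)) (hu l) z hzR'
      linarith
  -- Summed over `l` first, this double family gives the terms of the functional equation; summed
  -- along antidiagonals, it gives the right-hand side through the recurrence. Absolute summability
  -- makes the two sums equal.
  set T : ℕ × (Fin d → ℕ) → ℕ × ℕ → ℂ := fun p kl =>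
    ξ ^ (kl.1 + kl.2) * (borelEqCoeff q m₀ c p kl.1 z / ((q : ℂ) ^ (kl.1 + m₀ - p.1)) ^ kl.2 *
        multiDz p.2 (borelCoeff q X kl.2) z) with hT
  set G : ℕ × (Fin d → ℕ) → ℕ → ℂ := fun p k =>
    borelEqCoeff q m₀ c p k z * ξ ^ k *
      multiDz p.2 (borelSum q X (ξ / (q : ℂ) ^ (k + m₀ - p.1))) z with hG
  have hTsum : ∀ p ∈ indexSet d m δ, Summable (T p) := by
    intro p hp
    obtain ⟨M, hM0, hM⟩ := hDbound p.2
    have hprod : Summable fun kl : ℕ × ℕ => A * (1 / 2 : ℝ) ^ kl.1 * (M * (1 / 2 : ℝ) ^ kl.2) :=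
      (summable_half A).mul_of_nonneg (summable_half M) (fun k => by positivity)
        (fun l => by positivity)
    refine Summable.of_norm_bounded hprod fun kl => ?_
    obtain ⟨k, l⟩ := kl
    simp only [hT, norm_mul, norm_div, norm_pow, Complex.norm_of_nonneg hq.le, pow_add]
    have h1 : ‖borelEqCoeff q m₀ c p k z‖ / (q ^ (k + m₀ - p.1)) ^ l ≤ A * B ^ k :=
      (div_le_self (norm_nonneg _) (one_le_pow₀ (one_le_pow₀ h.one_lt_q.le))).trans
        (h.norm_borelEqCoeff_le' hp k hzρ)
    calc ‖ξ‖ ^ k * ‖ξ‖ ^ l * (‖borelEqCoeff q m₀ c p k z‖ / (q ^ (k + m₀ - p.1)) ^ l *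
          ‖multiDz p.2 (borelCoeff q X l) z‖)
        ≤ r ^ k * r ^ l * (A * B ^ k * (M * η ^ l)) := by
          have := hM l
          gcongr
      _ = A * (r * B) ^ k * (M * (r * η) ^ l) := by simp only [mul_pow]; ring
      _ ≤ A * (1 / 2) ^ k * (M * (1 / 2) ^ l) := by gcongr
  have hfiber : ∀ p ∈ indexSet d m δ, HasSum (G p) (∑' kl, T p kl) := by
    intro p hp
    refine (hTsum p hp).hasSum.prod_fiberwise fun k => ?_
    have h1 := (hDsum p.2 (ξ / (q : ℂ) ^ (k + m₀ - p.1)) ((hqs _).trans hξ)).mul_left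
      (borelEqCoeff q m₀ c p k z * ξ ^ k)
    have h2 : (fun l => T p (k, l)) = fun l => borelEqCoeff q m₀ c p k z * ξ ^ k *
        ((ξ / (q : ℂ) ^ (k + m₀ - p.1)) ^ l * multiDz p.2 (borelCoeff q X l) z) := by
      funext l
      simp only [hT, pow_add, div_pow]
      ring
    rw [h2]
    exact h1
  have hanti : ∀ p ∈ indexSet d m δ,
      HasSum (fun n => ∑ kl ∈ Finset.HasAntidiagonal.antidiagonal n, T p kl) (∑' kl, T p kl) := by
    intro p hp
    have h1 := (Finset.HasAntidiagonal.sigmaAntidiagonalEquivProd.hasSum_iff.2 (hTsum p hp).hasSum)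
    refine h1.sigma fun n => ?_
    exact Finset.hasSum (Finset.HasAntidiagonal.antidiagonal n) (T p)
  have hrhs : borelRhs q m₀ F ξ z = ∑ p ∈ indexSet d m δ, ∑' kl, T p kl := by
    rw [borelRhs]
    refine HasSum.tsum_eq ?_
    have h1 := hasSum_sum hanti
    convert h1 using 1
    ext n
    rw [← h.borel_recurrence n hzρ, Finset.sum_mul]
    refine Finset.sum_congr rfl fun p _ => ?_
    rw [Finset.sum_mul]
    refine Finset.sum_congr rfl fun kl hkl => ?_
    rw [Finset.HasAntidiagonal.mem_antidiagonal] at hkl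
    simp only [hT, hkl]
    ring
  rw [hrhs, ← sum_main_eq_mainPoly h.delta_pos, perturbation, ← Finset.sum_add_distrib]
  refine Finset.sum_congr rfl fun p hp => ?_
  set Mp : ℂ := if m₀ ≤ p.1 ∧ len p.2 = 0 then
      borelEqCoeff q m₀ c p (p.1 - m₀) z * ξ ^ (p.1 - m₀) * borelSum q X ξ z else 0 with hMp
  have hpert : HasSum (fun i => perturbationTerm q m₀ c (borelSum q X) p i ξ z)
      (∑' kl, T p kl - Mp) := by
    -- The undilated term sits at the single index `p.1 - m₀`. If `p.1 < m₀`, the truncated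
    -- subtraction gives index `0`, where `Mp = 0`.
    have h1 : HasSum (fun i => if i = p.1 - m₀ then Mp else 0) Mp := hasSum_ite_eq _ _
    suffices hfun : (fun i => perturbationTerm q m₀ c (borelSum q X) p i ξ z) =
        fun i => G p i - if i = p.1 - m₀ then Mp else 0 by
      rw [hfun]
      exact (hfiber p hp).sub h1
    funext i
    simp only [perturbationTerm, hG]
    rcases lt_trichotomy (i + m₀) p.1 with hi | hi | hi
    · rw [if_pos hi.le, if_neg (by omega), h.borelEqCoeff_eq_zero hp hi hzρ]
      simp
    · rw [if_pos hi.le, if_pos (by omega), hMp]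
      by_cases hlen : len p.2 = 0
      · rw [if_pos ⟨by omega, hlen⟩, multiDz_of_len_eq_zero hlen]
        have h2 : p.1 - m₀ = i := by omega
        have h3 : i + m₀ - p.1 = 0 := by omega
        rw [h2, h3, pow_zero, div_one, sub_self]
      · rw [if_neg fun h => hlen h.2, h.borelEqCoeff_eq_zero_of_len_pos hp
          (Nat.pos_of_ne_zero hlen) (Or.inr hi.le) hzρ]
        simp
    · rw [if_neg (by omega)]
      by_cases hi' : i = p.1 - m₀
      · have : Mp = 0 := by
          rw [hMp, if_neg]
          rintro ⟨h1, -⟩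
          omega
        rw [this]
        simp
      · rw [if_neg hi', sub_zero]
  rw [hpert.tsum_eq]
  ring

end NormalizedEquation

/-! ### Geometry of sectors. -/

section Sector

/-- With `θ ≤ π` the quotient `ξ / lam` avoids the negative real axis, so `arg` is continuous there.
-/
theorem isOpen_sector {θ : ℝ} (hθ : θ ≤ Real.pi) {lam : ℂ} (hlam : lam ≠ 0) :
    IsOpen (sector θ lam) := by
  rw [isOpen_iff_mem_nhds]
  rintro ξ ⟨hξ, harg⟩
  have hslit : ξ / lam ∈ Complex.slitPlane := by
    rw [Complex.mem_slitPlane_iff_arg]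
    refine ⟨fun h => ?_, div_ne_zero hξ hlam⟩
    rw [h, abs_of_pos Real.pi_pos] at harg
    linarith
  have hc : ContinuousAt (fun ξ : ℂ => |(ξ / lam).arg|) ξ := by
    refine ContinuousAt.abs ?_
    exact ContinuousAt.comp (f := fun ξ : ℂ => ξ / lam) (Complex.continuousAt_arg hslit)
      (by fun_prop)
  filter_upwards [isOpen_ne.mem_nhds hξ, hc.eventually (gt_mem_nhds harg)] with ζ h1 h2
  exact ⟨h1, h2⟩

theorem mul_mem_sector {θ : ℝ} {lam ξ : ℂ} (hξ : ξ ∈ sector θ lam) {x : ℝ} (hx : 0 < x) :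
    (x : ℂ) * ξ ∈ sector θ lam := by
  refine ⟨mul_ne_zero (by exact_mod_cast hx.ne') hξ.1, ?_⟩
  rw [mul_div_assoc, Complex.arg_real_mul _ hx]
  exact hξ.2

theorem self_mem_sector {θ : ℝ} (hθ : 0 < θ) {lam : ℂ} (hlam : lam ≠ 0) : lam ∈ sector θ lam :=
  ⟨hlam, by rw [div_self hlam, Complex.arg_one, abs_zero]; exact hθ⟩

theorem div_norm_eq_of_mem_sector {lam ξ : ℂ} (hlam : lam ≠ 0) (hξ : ξ ≠ 0) :
    ξ / ‖ξ‖ = lam / ‖lam‖ * Complex.exp ((ξ / lam).arg * Complex.I) := by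
  have h1 := Complex.norm_mul_exp_arg_mul_I (ξ / lam)
  have h2 : (‖ξ‖ : ℂ) ≠ 0 := by exact_mod_cast (norm_pos_iff.2 hξ).ne'
  have h3 : (‖lam‖ : ℂ) ≠ 0 := by exact_mod_cast (norm_pos_iff.2 hlam).ne'
  rw [norm_div] at h1
  push_cast at h1
  have h4 : Complex.exp ((ξ / lam).arg * Complex.I) = ‖lam‖ / ‖ξ‖ * (ξ / lam) := by
    generalize Complex.exp ((ξ / lam).arg * Complex.I) = e at h1 ⊢
    rw [← h1]
    field_simp
  rw [h4]
  field_simp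

end Sector

/-! ### Lower bound for the characteristic polynomial on a thin sector. -/

/-- The homogenization of the characteristic polynomial. -/
noncomputable def homPoly (q : ℝ) (m m₀ : ℕ) (c : ℕ × (Fin d → ℕ) → ℕ → (Fin d → ℂ) → ℂ)
    (x : ℝ) (w : ℂ) (z : Fin d → ℂ) : ℂ :=
  ∑ j ∈ Finset.Icc m₀ m,
    c (j, 0) (j - m₀) z / (q : ℂ) ^ tri j * (x * w) ^ (j - m₀) * (1 - x) ^ (m - j)

/-- With `y = x / (1 - x)` the half-line `y ≥ 0` becomes `[0, 1)`, and `x = 1`, where only the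
leading coefficient survives, compactifies it. -/
theorem homPoly_eq (q : ℝ) {m m₀ : ℕ} (c : ℕ × (Fin d → ℕ) → ℕ → (Fin d → ℂ) → ℂ)
    {x y : ℝ} (hxy : y * (1 - x) = x) (w : ℂ) (z : Fin d → ℂ) :
    homPoly q m m₀ c x w z = mainPoly q m m₀ c (y * w) z * (1 - x) ^ (m - m₀) := by
  rw [homPoly, mainPoly, Finset.sum_mul]
  refine Finset.sum_congr rfl fun j hj => ?_
  rw [Finset.mem_Icc] at hj
  have h1 : m - m₀ = (j - m₀) + (m - j) := by omega
  have h2 : (x : ℂ) = y * (1 - x) := by exact_mod_cast hxy.symm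
  rw [h1, pow_add]
  nth_rw 1 [h2]
  rw [show (y : ℂ) * (1 - x) * w = y * w * (1 - x) by ring, mul_pow (y * w : ℂ)]
  ring

/-- In the direction of `lam` and at `z = 0`, `homPoly` has no zero on `[0, 1]`: at `0` it is the
constant coefficient, at `1` the leading one times a unit, and in between `hroot` applies.
Compactness of `[0, 1]` gives a positive minimum, and the tube lemma keeps half of it for nearby
directions and small `z`. -/
theorem NormalizedEquation.exists_le_norm_mainPoly {q δ : ℝ} {m m₀ : ℕ}
    {c : ℕ × (Fin d → ℕ) → ℕ → (Fin d → ℂ) → ℂ} {F X : ℕ → (Fin d → ℂ) → ℂ} {ρ A B : ℝ}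
    (h : NormalizedEquation q δ m m₀ c F X ρ A B) {lam : ℂ} (hlam : lam ≠ 0)
    (hroot : ∀ x : ℝ, 0 < x → mainPoly q m m₀ c (x * lam) 0 ≠ 0) :
    ∃ θ ρ₂ ε : ℝ, 0 < θ ∧ θ ≤ Real.pi ∧ 0 < ρ₂ ∧ ρ₂ ≤ ρ ∧ 0 < ε ∧
      ∀ ξ ∈ sector θ lam, ∀ z ∈ ball (0 : Fin d → ℂ) ρ₂,
        ε * (1 + ‖ξ‖) ^ (m - m₀) ≤ ‖mainPoly q m m₀ c ξ z‖ := by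
  have hlam0 : 0 < ‖lam‖ := norm_pos_iff.2 hlam
  set w₀ : ℂ := lam / ‖lam‖ with hw₀
  have hw₀ne : w₀ ≠ 0 := div_ne_zero hlam (by exact_mod_cast hlam0.ne')
  have hcont : ∀ x : ℝ, ContinuousAt
      (fun v : (ℂ × (Fin d → ℂ)) × ℝ => ‖homPoly q m m₀ c v.2 v.1.1 v.1.2‖) ((w₀, 0), x) := by
    intro x
    refine ContinuousAt.norm ?_
    unfold homPoly
    refine tendsto_finsetSum _ fun j hj => ?_
    rw [Finset.mem_Icc] at hj
    have h1 : ContinuousAt (c (j, 0) (j - m₀)) 0 :=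
      (h.analytic_c _ (mem_indexSet_zero h.delta_pos hj.2) _ 0
        (mem_ball_self h.rho_pos)).continuousAt
    have h2 : ContinuousAt (fun v : (ℂ × (Fin d → ℂ)) × ℝ => c (j, 0) (j - m₀) v.1.2)
        ((w₀, 0), x) :=
      ContinuousAt.comp (f := fun v : (ℂ × (Fin d → ℂ)) × ℝ => v.1.2) h1 (by fun_prop)
    refine Tendsto.mul (Tendsto.mul (h2.tendsto.div_const _) ?_) ?_
    · exact ContinuousAt.tendsto (f := fun v : (ℂ × (Fin d → ℂ)) × ℝ =>
        ((v.2 : ℂ) * v.1.1) ^ (j - m₀)) (x := ((w₀, 0), x)) (by fun_prop)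
    · exact ContinuousAt.tendsto (f := fun v : (ℂ × (Fin d → ℂ)) × ℝ =>
        (1 - (v.2 : ℂ)) ^ (m - j)) (x := ((w₀, 0), x)) (by fun_prop)
  have hne : ∀ x ∈ Set.Icc (0 : ℝ) 1, homPoly q m m₀ c x w₀ 0 ≠ 0 := by
    rintro x ⟨hx0, hx1⟩
    rcases hx1.lt_or_eq with hx | rfl
    · have hx' : (1 - x) ≠ 0 := by linarith
      rw [homPoly_eq q c (y := x / (1 - x)) (div_mul_cancel₀ _ hx')]
      refine mul_ne_zero ?_ (pow_ne_zero _ (by exact_mod_cast hx'))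
      rcases hx0.eq_or_lt with rfl | hx0
      · rw [mainPoly, ← Finset.Ioc_insert_left h.lt_m.le,
          Finset.sum_insert Finset.left_notMem_Ioc, Finset.sum_eq_zero, add_zero]
        · rw [Nat.sub_self, pow_zero, mul_one]
          exact div_ne_zero h.lower_ne (pow_ne_zero _ h.qC_ne)
        · intro j hj
          rw [Finset.mem_Ioc] at hj
          rw [zero_div, Complex.ofReal_zero, zero_mul, zero_pow (by omega), mul_zero]
      · have := hroot (x / (1 - x) / ‖lam‖) (by
          have : 0 < 1 - x := by linarith
          positivity)
        convert this using 2
        rw [hw₀]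
        push_cast
        ring
    · rw [homPoly, ← Finset.Ico_insert_right h.lt_m.le,
        Finset.sum_insert Finset.right_notMem_Ico, Finset.sum_eq_zero, add_zero]
      · rw [Nat.sub_self, pow_zero, mul_one]
        refine mul_ne_zero (div_ne_zero h.upper_ne (pow_ne_zero _ h.qC_ne)) (pow_ne_zero _ ?_)
        simpa using hw₀ne
      · intro j hj
        rw [Finset.mem_Ico] at hj
        rw [Complex.ofReal_one, sub_self, zero_pow (by omega), mul_zero]
  have hcont₀ : ContinuousOn (fun x : ℝ => ‖homPoly q m m₀ c x w₀ 0‖) (Set.Icc 0 1) := by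
    intro x _
    exact (ContinuousAt.comp (f := fun x : ℝ => (((w₀, 0), x) : (ℂ × (Fin d → ℂ)) × ℝ)) (hcont x)
      (by fun_prop)).continuousWithinAt
  obtain ⟨x₀, hx₀, hmin⟩ := isCompact_Icc.exists_isMinOn (Set.nonempty_Icc.2 zero_le_one) hcont₀
  set ε : ℝ := ‖homPoly q m m₀ c x₀ w₀ 0‖ / 2
  have hε : 0 < ε := half_pos (norm_pos_iff.2 (hne x₀ hx₀))
  have htube : ∀ᶠ v in 𝓝 ((w₀, 0) : ℂ × (Fin d → ℂ)), ∀ x ∈ Set.Icc (0 : ℝ) 1,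
      ε < ‖homPoly q m m₀ c x v.1 v.2‖ := by
    refine isCompact_Icc.eventually_forall_of_forall_eventually fun x hx => ?_
    refine (hcont x).eventually (lt_mem_nhds ?_)
    have h1 : ‖homPoly q m m₀ c x₀ w₀ 0‖ ≤ ‖homPoly q m m₀ c x w₀ 0‖ := hmin hx
    have h2 : ε < ‖homPoly q m m₀ c x₀ w₀ 0‖ := half_lt_self (norm_pos_iff.2 (hne x₀ hx₀))
    exact h2.trans_le h1
  obtain ⟨s, hs, hball⟩ := Metric.mem_nhds_iff.1 htube
  have hrot : ContinuousAt (fun φ : ℝ => w₀ * Complex.exp (φ * Complex.I)) 0 := by fun_prop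
  have hrot0 : w₀ * Complex.exp ((0 : ℝ) * Complex.I) = w₀ := by simp
  obtain ⟨θ, hθ, hθball⟩ := Metric.continuousAt_iff.1 hrot s hs
  rw [hrot0] at hθball
  refine ⟨min θ Real.pi, min s ρ, ε, lt_min hθ Real.pi_pos, min_le_right _ _,
    lt_min hs h.rho_pos, min_le_right _ _, hε, ?_⟩
  rintro ξ ⟨hξ, harg⟩ z hz
  have hξ0 : 0 < ‖ξ‖ := norm_pos_iff.2 hξ
  have hw : dist (ξ / ‖ξ‖) w₀ < s := by
    rw [div_norm_eq_of_mem_sector hlam hξ]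
    refine hθball ?_
    rw [Real.dist_eq, sub_zero]
    exact harg.trans_le (min_le_left _ _)
  have hmem : ((ξ / ‖ξ‖, z) : ℂ × (Fin d → ℂ)) ∈ ball (w₀, 0) s := by
    rw [mem_ball, Prod.dist_eq]
    exact max_lt hw ((mem_ball.1 hz).trans_le (min_le_left _ _))
  have h1pos : 0 < 1 + ‖ξ‖ := by linarith
  -- This parameter corresponds to `y = ‖ξ‖`, and `1 - x = (1 + ‖ξ‖)⁻¹` yields the power `(1 + ‖ξ‖)
  -- ^ (m - m₀)`.
  have h1 := hball hmem (‖ξ‖ / (1 + ‖ξ‖))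
    ⟨by positivity, (div_le_one h1pos).2 (by linarith)⟩
  have h2 : 1 - ‖ξ‖ / (1 + ‖ξ‖) = (1 + ‖ξ‖)⁻¹ := by field_simp; ring
  simp only at h1
  rw [homPoly_eq q c (y := ‖ξ‖) (by rw [h2]; rfl)] at h1
  have h3 : (‖ξ‖ : ℂ) * (ξ / ‖ξ‖) = ξ :=
    mul_div_cancel₀ _ (by exact_mod_cast hξ0.ne')
  have h4 : (1 - ((‖ξ‖ / (1 + ‖ξ‖) : ℝ) : ℂ)) = (((1 + ‖ξ‖)⁻¹ : ℝ) : ℂ) := by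
    rw [← h2]; push_cast; ring
  rw [h3, h4, norm_mul, norm_pow, Complex.norm_of_nonneg (inv_nonneg.2 h1pos.le), inv_pow,
    ← div_eq_mul_inv, lt_div_iff₀ (by positivity)] at h1
  exact h1.le

/-! ### Inequalities for the Gaussian growth function. -/

section Gaussian

/-- The growth function `t ↦ q^{(t + x)²/2}`. -/
noncomputable def gaussGrowth (q x t : ℝ) : ℝ := q ^ ((t + x) ^ 2 / 2)

theorem one_le_gaussGrowth {q : ℝ} (hq : 1 < q) (x t : ℝ) : 1 ≤ gaussGrowth q x t :=
  Real.one_le_rpow hq.le (by positivity)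

theorem gaussGrowth_mono {q : ℝ} (hq : 1 < q) {x : ℝ} (hx : 0 ≤ x) {s t : ℝ} (hs : 0 ≤ s)
    (hst : s ≤ t) : gaussGrowth q x s ≤ gaussGrowth q x t := by
  refine Real.rpow_le_rpow_of_exponent_le hq.le ?_
  gcongr

/-- The exponents on the two sides differ by exactly `n (m - j - e) + j s ≥ 0`. Here `i` counts
powers of `ξ`, `e` is `1` when a derivative costs `q ^ n` and `0` otherwise, and each dilation gains
`q ^ (1 / 2 - x)`. -/
theorem pow_mul_gaussGrowth_le {q : ℝ} (hq : 1 < q) {n s i j e m m₀ : ℕ} (x : ℝ)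
    (hs : s + j = i + m₀) (hje : j + e ≤ m) (hm : m₀ ≤ m) :
    q ^ (n * i) * q ^ (n * e) / q ^ (tri s + j * s) * gaussGrowth q x ((n : ℝ) - s)
      ≤ q ^ (n * (m - m₀)) * gaussGrowth q x n * (q ^ (1 / 2 - x : ℝ)) ^ s := by
  have hq0 : 0 < q := by linarith
  simp only [gaussGrowth, ← Real.rpow_natCast, ← Real.rpow_mul hq0.le, ← Real.rpow_add hq0,
    ← Real.rpow_sub hq0]
  refine Real.rpow_le_rpow_of_exponent_le hq.le ?_
  have htri := two_mul_tri_cast s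
  have hs' : (i : ℝ) = s + j - m₀ := by
    have : (s : ℝ) + j = i + m₀ := by exact_mod_cast hs
    linarith
  have hje' : (j : ℝ) + e ≤ m := by exact_mod_cast hje
  have h1 : 0 ≤ (n : ℝ) * (m - j - e) := mul_nonneg (Nat.cast_nonneg _) (by linarith)
  have h2 : 0 ≤ (j : ℝ) * s := by positivity
  push_cast [Nat.cast_sub hm, Real.rpow_ofNat]
  rw [hs']
  nlinarith

/-- With `tri l` in place of `tri (l + m₀)`, the exponents differ by the square `(n + x - l)² / 2`.
-/
theorem pow_div_pow_tri_le {q : ℝ} (hq : 1 < q) (n l m₀ : ℕ) (x : ℝ) :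
    q ^ (n * l) / q ^ tri (l + m₀) ≤ gaussGrowth q x n * (q ^ (1 / 2 - x : ℝ)) ^ l := by
  have hq0 : 0 < q := by linarith
  simp only [gaussGrowth, ← Real.rpow_natCast, ← Real.rpow_mul hq0.le, ← Real.rpow_add hq0,
    ← Real.rpow_sub hq0]
  refine Real.rpow_le_rpow_of_exponent_le hq.le ?_
  have htri := two_mul_tri_cast l
  have h1 : (tri l : ℝ) ≤ tri (l + m₀) := by
    rw [tri_add]; push_cast
    have : (0 : ℝ) ≤ tri m₀ + l * m₀ := by positivity
    linarith
  push_cast [Real.rpow_ofNat]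
  nlinarith [sq_nonneg ((n : ℝ) + x - l)]

/-- One factor `B * y` is kept apart as the small parameter; the other `s - 1` factors provide
summability in `i`, since `i ≤ s + m`. -/
theorem pow_le_half_pow {y B : ℝ} (hy : 0 ≤ y) (hy2 : B * y ≤ 1 / 2) (hB : 1 ≤ B)
    {s i m : ℕ} (hs : 0 < s) (hi : i ≤ s + m) :
    B ^ i * y ^ s ≤ B ^ m * 2 ^ (m + 1) * (B * y) * (1 / 2) ^ i := by
  obtain ⟨s, rfl⟩ : ∃ t, s = t + 1 := ⟨s - 1, by omega⟩
  have hBy : 0 ≤ B * y := by positivity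
  have h1 : B ^ i ≤ B ^ (s + 1) * B ^ m := by
    rw [← pow_add]; exact pow_le_pow_right₀ hB hi
  have h2 : (B * y) ^ s ≤ 2 ^ (m + 1) * (1 / 2) ^ i := by
    have h3 : (1 / 2 : ℝ) ^ (s + (m + 1)) ≤ (1 / 2) ^ i :=
      pow_le_pow_of_le_one (by norm_num) (by norm_num) (by omega)
    calc (B * y) ^ s ≤ (1 / 2) ^ s := by gcongr
      _ = 2 ^ (m + 1) * (1 / 2) ^ (s + (m + 1)) := by
        rw [pow_add (1 / 2 : ℝ) s (m + 1), mul_left_comm, ← mul_pow]; norm_num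
      _ ≤ 2 ^ (m + 1) * (1 / 2) ^ i := by gcongr
  calc B ^ i * y ^ (s + 1) ≤ B ^ (s + 1) * B ^ m * y ^ (s + 1) := by gcongr
    _ = B ^ m * (B * y) * (B * y) ^ s := by rw [mul_pow, pow_succ, pow_succ]; ring
    _ ≤ B ^ m * (B * y) * (2 ^ (m + 1) * (1 / 2) ^ i) := by gcongr
    _ = _ := by ring

theorem exists_mul_rpow_le {q B e : ℝ} (hq : 1 < q) (hB : 0 < B) (he : 0 < e) :
    ∃ x : ℝ, 0 ≤ x ∧ B * q ^ (1 / 2 - x) ≤ e := by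
  have hq0 : 0 < q := by linarith
  obtain ⟨k, hk⟩ := pow_unbounded_of_one_lt (B * q / e) hq
  refine ⟨k, Nat.cast_nonneg _, ?_⟩
  rw [Real.rpow_sub hq0, Real.rpow_natCast]
  have h1 : q ^ (1 / 2 : ℝ) ≤ q := by
    conv_rhs => rw [← Real.rpow_one q]
    exact Real.rpow_le_rpow_of_exponent_le hq.le (by norm_num)
  rw [div_lt_iff₀ he] at hk
  rw [mul_div_assoc', div_le_iff₀ (by positivity)]
  nlinarith

end Gaussian

/-! ### Extension along the sector, one factor `q` at a time. -/

/-- The successive approximations of the analytic extension of the `q`-Borel transform: each one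
solves the equation in terms of the preceding one. -/
noncomputable def approxExtension (q δ : ℝ) (m m₀ : ℕ)
    (c : ℕ × (Fin d → ℕ) → ℕ → (Fin d → ℂ) → ℂ) (F X : ℕ → (Fin d → ℂ) → ℂ) :
    ℕ → ℂ → (Fin d → ℂ) → ℂ
  | 0 => borelSum q X
  | k + 1 => fun ξ z => (borelRhs q m₀ F ξ z -
      perturbation q δ m m₀ c (approxExtension q δ m m₀ c F X k) ξ z) / mainPoly q m m₀ c ξ z

/-- The sector truncated at radius `r q^k`. -/
def truncSector (q θ r : ℝ) (lam : ℂ) (k : ℕ) : Set ℂ := sector θ lam ∩ ball 0 (r * q ^ k)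

/-- The local information on the `q`-Borel transform and on the characteristic polynomial needed to
extend the former along a sector. -/
structure SectorSetup (q δ : ℝ) (m m₀ : ℕ) (c : ℕ × (Fin d → ℕ) → ℕ → (Fin d → ℂ) → ℂ)
    (F X : ℕ → (Fin d → ℂ) → ℂ) (ρ A B : ℝ) (lam : ℂ) (θ R κ C K₀ ε r : ℝ) : Prop where
  eqn : NormalizedEquation q δ m m₀ c F X ρ A B
  lam_ne : lam ≠ 0
  theta_pos : 0 < θ
  theta_le : θ ≤ Real.pi
  R_pos : 0 < R
  two_R_le : 2 * R ≤ ρ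
  one_lt_kappa : 1 < κ
  one_le_C : 1 ≤ C
  derivative_le : ∀ p ∈ indexSet d m δ, ∀ l n : ℕ, l < n →
      ∀ (f : (Fin d → ℂ) → ℂ) (M : ℝ), AnalyticOnNhd ℂ f (ball 0 (radius R κ l)) →
      (∀ z ∈ ball (0 : Fin d → ℂ) (radius R κ l), ‖f z‖ ≤ M) →
      ∀ z ∈ ball (0 : Fin d → ℂ) (radius R κ n), ‖multiDz p.2 f z‖ ≤ C * q ^ n * M
  r_pos : 0 < r
  r_le_one : r ≤ 1
  eps_pos : 0 < ε
  analytic_u : AnalyticOnNhd ℂ (fun w : ℂ × (Fin d → ℂ) => borelSum q X w.1 w.2)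
      (ball (0 : ℂ) r ×ˢ ball 0 (2 * R))
  norm_u_le : ∀ ξ ∈ ball (0 : ℂ) r, ∀ z ∈ ball (0 : Fin d → ℂ) (2 * R), ‖borelSum q X ξ z‖ ≤ K₀
  equation_u : ∀ ξ ∈ ball (0 : ℂ) r, ∀ z ∈ ball (0 : Fin d → ℂ) (2 * R),
    mainPoly q m m₀ c ξ z * borelSum q X ξ z + perturbation q δ m m₀ c (borelSum q X) ξ z
      = borelRhs q m₀ F ξ z
  le_norm_mainPoly : ∀ ξ ∈ sector θ lam, ∀ z ∈ ball (0 : Fin d → ℂ) (2 * R),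
    ε * (1 + ‖ξ‖) ^ (m - m₀) ≤ ‖mainPoly q m m₀ c ξ z‖

namespace SectorSetup

variable {q δ : ℝ} {m m₀ : ℕ} {c : ℕ × (Fin d → ℕ) → ℕ → (Fin d → ℂ) → ℂ}
  {F X : ℕ → (Fin d → ℂ) → ℂ} {ρ A B : ℝ} {lam : ℂ} {θ R κ C K₀ ε r : ℝ}

theorem isOpen_truncSector (h : SectorSetup q δ m m₀ c F X ρ A B lam θ R κ C K₀ ε r) (k : ℕ) :
    IsOpen (truncSector q θ r lam k) :=
  (isOpen_sector h.theta_le h.lam_ne).inter isOpen_ball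

theorem truncSector_mono (h : SectorSetup q δ m m₀ c F X ρ A B lam θ R κ C K₀ ε r) {k l : ℕ}
    (hkl : k ≤ l) : truncSector q θ r lam k ⊆ truncSector q θ r lam l := by
  refine Set.inter_subset_inter_right _ (ball_subset_ball ?_)
  have := h.r_pos
  have := h.eqn.one_lt_q.le
  gcongr

theorem div_mem_truncSector (h : SectorSetup q δ m m₀ c F X ρ A B lam θ R κ C K₀ ε r) {k l s : ℕ}
    (hks : k ≤ l + s) {ξ : ℂ} (hξ : ξ ∈ truncSector q θ r lam k) :
    ξ / (q : ℂ) ^ s ∈ truncSector q θ r lam l := by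
  have hq := h.eqn.q_pos
  refine ⟨?_, ?_⟩
  · have := mul_mem_sector hξ.1 (x := (q ^ s)⁻¹) (by positivity)
    push_cast at this
    rwa [← div_eq_inv_mul] at this
  · have h1 := mem_ball_zero_iff.1 hξ.2
    rw [mem_ball_zero_iff, norm_div, norm_pow, Complex.norm_of_nonneg hq.le,
      div_lt_iff₀ (by positivity), mul_assoc, ← pow_add]
    refine h1.trans_le ?_
    have := h.r_pos
    have := h.eqn.one_lt_q.le
    gcongr

theorem radius_le (h : SectorSetup q δ m m₀ c F X ρ A B lam θ R κ C K₀ ε r) (n : ℕ) :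
    radius R κ n ≤ 2 * R := by
  have := radius_anti h.R_pos h.one_lt_kappa (Nat.zero_le n)
  rwa [radius_zero] at this

theorem norm_le_pow (h : SectorSetup q δ m m₀ c F X ρ A B lam θ R κ C K₀ ε r) {n : ℕ} {ξ : ℂ}
    (hξ : ξ ∈ truncSector q θ r lam n) : ‖ξ‖ ≤ q ^ n := by
  have h1 := mem_ball_zero_iff.1 hξ.2
  have h2 : 0 < q ^ n := pow_pos h.eqn.q_pos n
  have h3 := h.r_le_one
  nlinarith

theorem mainPoly_ne_zero (h : SectorSetup q δ m m₀ c F X ρ A B lam θ R κ C K₀ ε r) {ξ : ℂ}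
    (hξ : ξ ∈ sector θ lam) {z : Fin d → ℂ} (hz : z ∈ ball 0 (2 * R)) :
    mainPoly q m m₀ c ξ z ≠ 0 := by
  have h1 := h.le_norm_mainPoly ξ hξ z hz
  have h2 : 0 < ε * (1 + ‖ξ‖) ^ (m - m₀) := by
    have := h.eps_pos
    positivity
  exact norm_pos_iff.1 (h2.trans_le h1)

theorem analytic_mainPoly (h : SectorSetup q δ m m₀ c F X ρ A B lam θ R κ C K₀ ε r) (k : ℕ) :
    AnalyticOnNhd ℂ (fun w : ℂ × (Fin d → ℂ) => mainPoly q m m₀ c w.1 w.2)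
      (truncSector q θ r lam k ×ˢ ball 0 (radius R κ k)) := by
  unfold mainPoly
  refine Finset.analyticOnNhd_fun_sum _ fun j hj => ?_
  rintro w ⟨-, hw⟩
  rw [Finset.mem_Icc] at hj
  have h1 := h.eqn.analytic_c _ (mem_indexSet_zero h.eqn.delta_pos hj.2) (j - m₀) w.2
    (ball_subset_ball ((h.radius_le k).trans h.two_R_le) hw)
  exact ((h1.comp analyticAt_snd).div analyticAt_const (pow_ne_zero _ h.eqn.qC_ne)).mul
    (analyticAt_fst.pow _)

theorem norm_borelRhs_term_le (h : SectorSetup q δ m m₀ c F X ρ A B lam θ R κ C K₀ ε r) {x : ℝ}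
    (hx : B * q ^ (1 / 2 - x) ≤ 1 / 2) {n : ℕ} {ξ : ℂ} (hξ : ‖ξ‖ ≤ q ^ n) {z : Fin d → ℂ}
    (hz : z ∈ ball 0 ρ) (l : ℕ) :
    ‖F l z / (q : ℂ) ^ tri (l + m₀) * ξ ^ l‖ ≤ A * gaussGrowth q x n * (1 / 2) ^ l := by
  have hq := h.eqn.q_pos
  have hA := h.eqn.one_le_A
  have hB := h.eqn.one_le_B
  have hG := one_le_gaussGrowth h.eqn.one_lt_q x n
  rw [norm_mul, norm_div, norm_pow, norm_pow, Complex.norm_of_nonneg hq.le]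
  have h1 := h.eqn.norm_F_le l z hz
  have h2 := pow_div_pow_tri_le h.eqn.one_lt_q n l m₀ x
  calc ‖F l z‖ / q ^ tri (l + m₀) * ‖ξ‖ ^ l
      ≤ A * B ^ l / q ^ tri (l + m₀) * (q ^ n) ^ l := by gcongr
    _ = A * B ^ l * (q ^ (n * l) / q ^ tri (l + m₀)) := by rw [pow_mul]; ring
    _ ≤ A * B ^ l * (gaussGrowth q x n * (q ^ (1 / 2 - x : ℝ)) ^ l) := by gcongr
    _ = A * gaussGrowth q x n * (B * q ^ (1 / 2 - x : ℝ)) ^ l := by rw [mul_pow]; ring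
    _ ≤ A * gaussGrowth q x n * (1 / 2) ^ l := by gcongr

theorem norm_borelRhs_le (h : SectorSetup q δ m m₀ c F X ρ A B lam θ R κ C K₀ ε r) {x : ℝ}
    (hx : B * q ^ (1 / 2 - x) ≤ 1 / 2) {n : ℕ} {ξ : ℂ} (hξ : ‖ξ‖ ≤ q ^ n) {z : Fin d → ℂ}
    (hz : z ∈ ball 0 ρ) : ‖borelRhs q m₀ F ξ z‖ ≤ 2 * (A * gaussGrowth q x n) := by
  have := tsum_of_norm_bounded ((hasSum_geometric_two).mul_left (A * gaussGrowth q x n))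
    fun l => h.norm_borelRhs_term_le hx hξ hz l
  rw [borelRhs]
  linarith

theorem analytic_borelRhs (h : SectorSetup q δ m m₀ c F X ρ A B lam θ R κ C K₀ ε r) {x : ℝ}
    (hx : B * q ^ (1 / 2 - x) ≤ 1 / 2) (k : ℕ) :
    AnalyticOnNhd ℂ (fun w : ℂ × (Fin d → ℂ) => borelRhs q m₀ F w.1 w.2)
      (truncSector q θ r lam k ×ˢ ball 0 (radius R κ k)) := by
  have hsub : ball (0 : Fin d → ℂ) (radius R κ k) ⊆ ball 0 ρ :=
    ball_subset_ball ((h.radius_le k).trans h.two_R_le)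
  refine analyticOnNhd_tsum ((h.isOpen_truncSector k).prod isOpen_ball)
    (NormalizedEquation.summable_half (A * gaussGrowth q x k)) ?_ ?_
  · rintro l w ⟨-, hw⟩
    exact (((h.eqn.analytic_F l w.2 (hsub hw)).comp analyticAt_snd).div analyticAt_const
      (pow_ne_zero _ h.eqn.qC_ne)).mul (analyticAt_fst.pow _)
  · rintro l w ⟨hw1, hw2⟩
    exact h.norm_borelRhs_term_le hx (h.norm_le_pow hw1) (hsub hw2) l

/-- The estimate of one term of the perturbation. -/
theorem norm_perturbationTerm_le (h : SectorSetup q δ m m₀ c F X ρ A B lam θ R κ C K₀ ε r)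
    {x : ℝ} (hx : B * q ^ (1 / 2 - x) ≤ 1 / 2) {K : ℝ} (hK : 0 ≤ K) {k : ℕ}
    {W : ℂ → (Fin d → ℂ) → ℂ}
    (hW : AnalyticOnNhd ℂ (fun w : ℂ × (Fin d → ℂ) => W w.1 w.2)
      (truncSector q θ r lam k ×ˢ ball 0 (radius R κ k)))
    (hbound : ∀ s : ℕ, 0 < s → ∀ ξ ∈ truncSector q θ r lam (k + 1),
      ∀ z ∈ ball (0 : Fin d → ℂ) (radius R κ k),
        ‖W (ξ / (q : ℂ) ^ s) z‖ ≤ K * gaussGrowth q x ((k + 1 : ℕ) - s))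
    {p : ℕ × (Fin d → ℕ)} (hp : p ∈ indexSet d m δ) (i : ℕ)
    {ξ : ℂ} (hξ : ξ ∈ truncSector q θ r lam (k + 1)) {z : Fin d → ℂ}
    (hz : z ∈ ball 0 (radius R κ (k + 1))) :
    ‖perturbationTerm q m₀ c W p i ξ z‖ ≤
      (A * C * K * B ^ m * 2 ^ (m + 1)) * (B * q ^ (1 / 2 - x)) * q ^ ((k + 1) * (m - m₀)) *
        gaussGrowth q x (k + 1 : ℕ) * (1 / 2) ^ i := by
  have hq := h.eqn.q_pos
  have hA := h.eqn.one_le_A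
  have hB := h.eqn.one_le_B
  have hC := h.one_le_C
  have hG := one_le_gaussGrowth h.eqn.one_lt_q x (k + 1 : ℕ)
  rw [perturbationTerm]
  split_ifs with hs
  · rw [norm_zero]
    positivity
  push Not at hs
  obtain ⟨s, hs'⟩ := Nat.exists_eq_add_of_lt hs
  set t := s + 1 with ht
  have hst : i + m₀ - p.1 = t := by omega
  have hti : t + p.1 = i + m₀ := by omega
  have hple := h.eqn.fst_le hp
  have hzρ : z ∈ ball (0 : Fin d → ℂ) ρ :=
    ball_subset_ball ((h.radius_le _).trans h.two_R_le) hz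
  have hzk : z ∈ ball (0 : Fin d → ℂ) (radius R κ k) :=
    ball_subset_ball (radius_anti h.R_pos h.one_lt_kappa (Nat.le_succ k)) hz
  have hcoef := h.eqn.norm_borelEqCoeff_le hp i hzρ
  rw [hst] at hcoef ⊢
  have hM0 : 0 ≤ K * gaussGrowth q x ((k + 1 : ℕ) - t) :=
    mul_nonneg hK (zero_le_one.trans (one_le_gaussGrowth h.eqn.one_lt_q _ _))
  -- `e = 1` when there are derivatives, allowed since then `p.1 < m`; otherwise `e = 0`.
  have hder : ∃ e : ℕ, p.1 + e ≤ m ∧ ‖multiDz p.2 (W (ξ / (q : ℂ) ^ t)) z‖ ≤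
      C * q ^ ((k + 1) * e) * (K * gaussGrowth q x ((k + 1 : ℕ) - t)) := by
    by_cases hlen : 0 < len p.2
    · refine ⟨1, h.eqn.fst_lt hp hlen, ?_⟩
      rw [mul_one]
      refine h.derivative_le p hp k (k + 1) (Nat.lt_succ_self k) _ _ ?_
        (hbound t (Nat.succ_pos s) ξ hξ) z hz
      intro w hw
      exact AnalyticAt.comp (f := fun w : Fin d → ℂ => (ξ / (q : ℂ) ^ t, w))
        (hW (ξ / (q : ℂ) ^ t, w) ⟨h.div_mem_truncSector (by omega) hξ, hw⟩)
        (analyticAt_const.prod analyticAt_id)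
    · refine ⟨0, hple, ?_⟩
      rw [multiDz_of_len_eq_zero (Nat.eq_zero_of_not_pos hlen), mul_zero, pow_zero, mul_one]
      exact (hbound t (Nat.succ_pos s) ξ hξ z hzk).trans (le_mul_of_one_le_left hM0 hC)
  obtain ⟨e, hpe, hder⟩ := hder
  have hexp := pow_mul_gaussGrowth_le h.eqn.one_lt_q (n := k + 1) x hti hpe h.eqn.lt_m.le
  have hhalf := pow_le_half_pow (Real.rpow_nonneg hq.le (1 / 2 - x)) hx hB
    (Nat.succ_pos s) (show i ≤ s + 1 + m by omega)
  rw [norm_mul, norm_mul, norm_pow]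
  have hξn := h.norm_le_pow hξ
  calc ‖borelEqCoeff q m₀ c p i z‖ * ‖ξ‖ ^ i * ‖multiDz p.2 (W (ξ / (q : ℂ) ^ t)) z‖
      ≤ A * B ^ i / q ^ (tri t + p.1 * t) * (q ^ (k + 1)) ^ i *
        (C * q ^ ((k + 1) * e) * (K * gaussGrowth q x ((k + 1 : ℕ) - t))) := by gcongr
    _ = A * C * K * B ^ i * (q ^ ((k + 1) * i) * q ^ ((k + 1) * e) / q ^ (tri t + p.1 * t) *
          gaussGrowth q x ((k + 1 : ℕ) - t)) := by rw [← pow_mul]; ring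
    _ ≤ A * C * K * B ^ i * (q ^ ((k + 1) * (m - m₀)) * gaussGrowth q x (k + 1 : ℕ) *
          (q ^ (1 / 2 - x : ℝ)) ^ t) := by gcongr
    _ = A * C * K * (q ^ ((k + 1) * (m - m₀)) * gaussGrowth q x (k + 1 : ℕ)) *
          (B ^ i * (q ^ (1 / 2 - x : ℝ)) ^ t) := by ring
    _ ≤ A * C * K * (q ^ ((k + 1) * (m - m₀)) * gaussGrowth q x (k + 1 : ℕ)) *
          (B ^ m * 2 ^ (m + 1) * (B * q ^ (1 / 2 - x : ℝ)) * (1 / 2) ^ i) := by gcongr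
    _ = _ := by ring

theorem analytic_perturbation (h : SectorSetup q δ m m₀ c F X ρ A B lam θ R κ C K₀ ε r)
    {x : ℝ} (hx : B * q ^ (1 / 2 - x) ≤ 1 / 2) {K : ℝ} (hK : 0 ≤ K) {k : ℕ}
    {W : ℂ → (Fin d → ℂ) → ℂ}
    (hW : AnalyticOnNhd ℂ (fun w : ℂ × (Fin d → ℂ) => W w.1 w.2)
      (truncSector q θ r lam k ×ˢ ball 0 (radius R κ k)))
    (hbound : ∀ s : ℕ, 0 < s → ∀ ξ ∈ truncSector q θ r lam (k + 1),
      ∀ z ∈ ball (0 : Fin d → ℂ) (radius R κ k),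
        ‖W (ξ / (q : ℂ) ^ s) z‖ ≤ K * gaussGrowth q x ((k + 1 : ℕ) - s)) :
    AnalyticOnNhd ℂ (fun w : ℂ × (Fin d → ℂ) => perturbation q δ m m₀ c W w.1 w.2)
      (truncSector q θ r lam (k + 1) ×ˢ ball 0 (radius R κ (k + 1))) := by
  refine Finset.analyticOnNhd_fun_sum _ fun p hp => ?_
  refine analyticOnNhd_tsum ((h.isOpen_truncSector (k + 1)).prod isOpen_ball)
    (NormalizedEquation.summable_half _) ?_
    (fun i w hw => h.norm_perturbationTerm_le hx hK hW hbound hp i hw.1 hw.2)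
  intro i
  simp only [perturbationTerm]
  by_cases hs : i + m₀ ≤ p.1
  · simp only [if_pos hs]
    exact analyticOnNhd_const
  simp only [if_neg hs]
  have hder : AnalyticOnNhd ℂ (fun w : ℂ × (Fin d → ℂ) =>
      multiDz p.2 (W (w.1 / (q : ℂ) ^ (i + m₀ - p.1))) w.2)
      (truncSector q θ r lam (k + 1) ×ˢ ball 0 (radius R κ (k + 1))) := by
    refine analyticOnNhd_multiDz_param p.2
      (G := fun ξ => W (ξ / (q : ℂ) ^ (i + m₀ - p.1))) ?_
    rintro w ⟨hw1, hw2⟩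
    have hmem : (w.1 / (q : ℂ) ^ (i + m₀ - p.1), w.2) ∈
        truncSector q θ r lam k ×ˢ ball (0 : Fin d → ℂ) (radius R κ k) :=
      ⟨h.div_mem_truncSector (by omega) hw1,
        ball_subset_ball (radius_anti h.R_pos h.one_lt_kappa (Nat.le_succ k)) hw2⟩
    exact AnalyticAt.comp
      (f := fun w : ℂ × (Fin d → ℂ) => (w.1 / (q : ℂ) ^ (i + m₀ - p.1), w.2)) (hW _ hmem)
      ((analyticAt_fst.div analyticAt_const (pow_ne_zero _ h.eqn.qC_ne)).prod analyticAt_snd)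
  intro w hw
  have h1 := h.eqn.analytic_borelEqCoeff hp i w.2
    (ball_subset_ball ((h.radius_le _).trans h.two_R_le) hw.2)
  exact ((h1.comp analyticAt_snd).mul (analyticAt_fst.pow i)).mul (hder w hw)

theorem norm_perturbation_le (h : SectorSetup q δ m m₀ c F X ρ A B lam θ R κ C K₀ ε r)
    {x : ℝ} (hx : B * q ^ (1 / 2 - x) ≤ 1 / 2) {K : ℝ} (hK : 0 ≤ K) {k : ℕ}
    {W : ℂ → (Fin d → ℂ) → ℂ}
    (hW : AnalyticOnNhd ℂ (fun w : ℂ × (Fin d → ℂ) => W w.1 w.2)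
      (truncSector q θ r lam k ×ˢ ball 0 (radius R κ k)))
    (hbound : ∀ s : ℕ, 0 < s → ∀ ξ ∈ truncSector q θ r lam (k + 1),
      ∀ z ∈ ball (0 : Fin d → ℂ) (radius R κ k),
        ‖W (ξ / (q : ℂ) ^ s) z‖ ≤ K * gaussGrowth q x ((k + 1 : ℕ) - s))
    {ξ : ℂ} (hξ : ξ ∈ truncSector q θ r lam (k + 1)) {z : Fin d → ℂ}
    (hz : z ∈ ball 0 (radius R κ (k + 1))) :
    ‖perturbation q δ m m₀ c W ξ z‖ ≤ (indexSet d m δ).card *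
      ((A * C * K * B ^ m * 2 ^ (m + 1)) * (B * q ^ (1 / 2 - x)) * q ^ ((k + 1) * (m - m₀)) *
        gaussGrowth q x (k + 1 : ℕ) * 2) := by
  rw [perturbation, ← nsmul_eq_mul]
  refine (norm_sum_le _ _).trans (Finset.sum_le_card_nsmul _ _ _ fun p hp => ?_)
  exact tsum_of_norm_bounded (hasSum_geometric_two.mul_left _)
    fun i => h.norm_perturbationTerm_le hx hK hW hbound hp i hξ hz

/-- Every dilation in the perturbation has exponent at least `1`, so its values on the next
truncated sector depend only on those on the present one. This makes successive approximations
agree. -/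
theorem perturbation_congr (h : SectorSetup q δ m m₀ c F X ρ A B lam θ R κ C K₀ ε r) {k : ℕ}
    {V W : ℂ → (Fin d → ℂ) → ℂ}
    (hVW : ∀ ξ ∈ truncSector q θ r lam k, ∀ z ∈ ball (0 : Fin d → ℂ) (radius R κ k),
      V ξ z = W ξ z)
    {ξ : ℂ} (hξ : ξ ∈ truncSector q θ r lam (k + 1)) {z : Fin d → ℂ}
    (hz : z ∈ ball 0 (radius R κ k)) :
    perturbation q δ m m₀ c V ξ z = perturbation q δ m m₀ c W ξ z := by
  refine Finset.sum_congr rfl fun p _ => tsum_congr fun i => ?_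
  rw [perturbationTerm, perturbationTerm]
  split_ifs with hs
  · rfl
  congr 1
  refine (multiDz_congr p.2 ?_).eq_of_nhds
  filter_upwards [isOpen_ball.mem_nhds hz] with w hw
  exact hVW _ (h.div_mem_truncSector (by omega) hξ) w hw

/-- The properties of the successive approximations of the analytic extension. -/
theorem approxExtension_spec (h : SectorSetup q δ m m₀ c F X ρ A B lam θ R κ C K₀ ε r)
    {x : ℝ} (hx0 : 0 ≤ x) (hx : B * q ^ (1 / 2 - x) ≤ 1 / 2) {K : ℝ} (hK : 0 ≤ K) (hK₀ : K₀ ≤ K)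
    (hK1 : 4 * A ≤ ε * (r / q) ^ (m - m₀) * K)
    (hx1 : (indexSet d m δ).card * (4 * (A * C * B ^ m * 2 ^ (m + 1))) * (B * q ^ (1 / 2 - x))
      ≤ ε * (r / q) ^ (m - m₀)) (k : ℕ) :
    AnalyticOnNhd ℂ (fun w : ℂ × (Fin d → ℂ) => approxExtension q δ m m₀ c F X k w.1 w.2)
      (truncSector q θ r lam k ×ˢ ball 0 (radius R κ k)) ∧
    (∀ ξ ∈ truncSector q θ r lam 0, ∀ z ∈ ball (0 : Fin d → ℂ) (radius R κ k),
      ‖approxExtension q δ m m₀ c F X k ξ z‖ ≤ K) ∧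
    (∀ n ≤ k, ∀ ξ ∈ truncSector q θ r lam n, ∀ z ∈ ball (0 : Fin d → ℂ) (radius R κ k),
      ‖approxExtension q δ m m₀ c F X k ξ z‖ ≤ K * gaussGrowth q x n) ∧
    (∀ ξ ∈ truncSector q θ r lam k, ∀ z ∈ ball (0 : Fin d → ℂ) (radius R κ k),
      approxExtension q δ m m₀ c F X (k + 1) ξ z = approxExtension q δ m m₀ c F X k ξ z) := by
  have hq := h.eqn.q_pos
  have hq1 := h.eqn.one_lt_q
  have hA := h.eqn.one_le_A
  have hB := h.eqn.one_le_B
  have hC := h.one_le_C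
  have hr := h.r_pos
  have hε := h.eps_pos
  have hKG : ∀ t, K ≤ K * gaussGrowth q x t := fun t =>
    le_mul_of_one_le_right hK (one_le_gaussGrowth hq1 x t)
  have hball0 : truncSector q θ r lam 0 ⊆ ball 0 r := fun ξ hξ => by
    have := hξ.2
    rwa [pow_zero, mul_one] at this
  induction k with
  | zero =>
    have hbd : ∀ ξ ∈ truncSector q θ r lam 0, ∀ z ∈ ball (0 : Fin d → ℂ) (radius R κ 0),
        ‖approxExtension q δ m m₀ c F X 0 ξ z‖ ≤ K := fun ξ hξ z hz =>
      (h.norm_u_le ξ (hball0 hξ) z (by rwa [radius_zero] at hz)).trans hK₀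
    refine ⟨?_, hbd, ?_, ?_⟩
    · rw [radius_zero]
      exact h.analytic_u.mono (Set.prod_mono hball0 subset_rfl)
    · intro n hn ξ hξ z hz
      obtain rfl : n = 0 := by omega
      exact (hbd ξ hξ z hz).trans (hKG _)
    · intro ξ hξ z hz
      rw [radius_zero] at hz
      have h1 := h.equation_u ξ (hball0 hξ) z hz
      have h2 := h.mainPoly_ne_zero hξ.1 hz
      simp only [approxExtension]
      rw [← h1, add_sub_cancel_right, mul_div_cancel_left₀ _ h2]
  | succ k ih =>
    obtain ⟨ih1, ih2, ih3, ih4⟩ := ih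
    have hrad : ball (0 : Fin d → ℂ) (radius R κ (k + 1)) ⊆ ball 0 (radius R κ k) :=
      ball_subset_ball (radius_anti h.R_pos h.one_lt_kappa (Nat.le_succ k))
    have hbound : ∀ s : ℕ, 0 < s → ∀ ξ ∈ truncSector q θ r lam (k + 1),
        ∀ z ∈ ball (0 : Fin d → ℂ) (radius R κ k),
        ‖approxExtension q δ m m₀ c F X k (ξ / (q : ℂ) ^ s) z‖ ≤
          K * gaussGrowth q x ((k + 1 : ℕ) - s) := by
      intro s hs ξ hξ z hz
      rcases le_or_gt s (k + 1) with hsk | hsk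
      · rw [← Nat.cast_sub hsk]
        exact ih3 (k + 1 - s) (by omega) _ (h.div_mem_truncSector (by omega) hξ) z hz
      -- For `s > k + 1` the point lies in the smallest truncated sector, where the bound is `K`
      -- itself; the Gaussian factor is at least `1` even at a negative argument.
      · exact (ih2 _ (h.div_mem_truncSector (by omega) hξ) z hz).trans (hKG _)
    have hne : ∀ ξ ∈ truncSector q θ r lam (k + 1),
        ∀ z ∈ ball (0 : Fin d → ℂ) (radius R κ (k + 1)), mainPoly q m m₀ c ξ z ≠ 0 :=
      fun ξ hξ z hz => h.mainPoly_ne_zero hξ.1 (ball_subset_ball (h.radius_le _) hz)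
    refine ⟨?_, ?_, ?_, ?_⟩
    · intro w hw
      simp only [approxExtension]
      exact ((h.analytic_borelRhs hx (k + 1) w hw).sub
        (h.analytic_perturbation hx hK ih1 hbound w hw)).div (h.analytic_mainPoly (k + 1) w hw)
        (hne _ hw.1 _ hw.2)
    · intro ξ hξ z hz
      rw [ih4 ξ (h.truncSector_mono (Nat.zero_le k) hξ) z (hrad hz)]
      exact ih2 ξ hξ z (hrad hz)
    · intro n hn ξ hξ z hz
      by_cases hξk : ξ ∈ truncSector q θ r lam k
      · rw [ih4 ξ hξk z (hrad hz)]
        rcases Nat.lt_or_ge k n with hkn | hkn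
        · refine (ih3 k le_rfl ξ hξk z (hrad hz)).trans ?_
          refine mul_le_mul_of_nonneg_left (gaussGrowth_mono hq1 hx0 (Nat.cast_nonneg _) ?_) hK
          exact_mod_cast hkn.le
        · exact ih3 n hkn ξ hξ z (hrad hz)
      · have hnk : n = k + 1 := by
          by_contra hne'
          exact hξk (h.truncSector_mono (show n ≤ k by omega) hξ)
        subst hnk
        -- Only the new shell remains. There `|P|` is at least `ε (r q^k)^D = E * Q`, which explains
        -- the `r / q` in `E`, and `Q` cancels the power of `q` in the perturbation bound.
        have hξlow : r * q ^ k ≤ ‖ξ‖ := by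
          by_contra hlt
          exact hξk ⟨hξ.1, mem_ball_zero_iff.2 (lt_of_not_ge hlt)⟩
        have hzρ : z ∈ ball (0 : Fin d → ℂ) ρ :=
          ball_subset_ball ((h.radius_le _).trans h.two_R_le) hz
        have hf := h.norm_borelRhs_le hx (h.norm_le_pow hξ) hzρ
        have hp := h.norm_perturbation_le hx hK ih1 hbound hξ hz
        have hmain := h.le_norm_mainPoly ξ hξ.1 z (ball_subset_ball (h.radius_le _) hz)
        set D := m - m₀
        set G := gaussGrowth q x (k + 1 : ℕ)
        have hG : 1 ≤ G := one_le_gaussGrowth hq1 x _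
        set E := ε * (r / q) ^ D
        have hE : 0 < E := by positivity
        set Q := q ^ ((k + 1) * D) with hQ
        have hQ1 : 1 ≤ Q := one_le_pow₀ hq1.le
        have hlow : E * Q ≤ ‖mainPoly q m m₀ c ξ z‖ := by
          refine le_trans ?_ hmain
          have h1 : E * Q = ε * (r * q ^ k) ^ D := by
            simp only [E, hQ]
            rw [pow_mul, mul_assoc, ← mul_pow, pow_succ]
            congr 2
            field_simp
          rw [h1]
          gcongr
          linarith
        have hEQ : 0 < E * Q := by positivity
        simp only [approxExtension]
        rw [norm_div, div_le_iff₀ (hEQ.trans_le hlow)]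
        have h1 : 2 * (A * G) ≤ E * Q * (K * G) / 2 := by
          have h2 : E * K * G ≤ E * K * G * Q := le_mul_of_one_le_right (by positivity) hQ1
          nlinarith
        have h2 : (indexSet d m δ).card * ((A * C * K * B ^ m * 2 ^ (m + 1)) *
            (B * q ^ (1 / 2 - x)) * Q * G * 2) ≤ E * Q * (K * G) / 2 := by
          have h3 := mul_le_mul_of_nonneg_right hx1 (show 0 ≤ Q * (K * G) / 2 by positivity)
          calc _ = _ := by ring
            _ ≤ _ := h3
            _ = _ := by ring
        calc _ ≤ _ := norm_sub_le _ _
          _ ≤ E * Q * (K * G) := by linarith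
          _ ≤ ‖mainPoly q m m₀ c ξ z‖ * (K * G) := by gcongr
          _ = _ := mul_comm _ _
    · intro ξ hξ z hz
      have hcongr := h.perturbation_congr ih4 hξ (hrad hz)
      change (borelRhs q m₀ F ξ z -
          perturbation q δ m m₀ c (approxExtension q δ m m₀ c F X (k + 1)) ξ z) /
            mainPoly q m m₀ c ξ z = (borelRhs q m₀ F ξ z -
          perturbation q δ m m₀ c (approxExtension q δ m m₀ c F X k) ξ z) / mainPoly q m m₀ c ξ z
      rw [hcongr]

theorem exists_mem_truncSector (h : SectorSetup q δ m m₀ c F X ρ A B lam θ R κ C K₀ ε r) {ξ : ℂ}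
    (hξ : ξ ∈ sector θ lam) : ∃ k, ξ ∈ truncSector q θ r lam k := by
  obtain ⟨k, hk⟩ := pow_unbounded_of_one_lt (‖ξ‖ / r) h.eqn.one_lt_q
  rw [div_lt_iff₀' h.r_pos] at hk
  exact ⟨k, hξ, mem_ball_zero_iff.2 hk⟩

/-- The `q`-Borel transform extends along the sector, and the extension is bounded by a Gaussian
growth function on the truncated sectors. -/
theorem exists_extension (h : SectorSetup q δ m m₀ c F X ρ A B lam θ R κ C K₀ ε r) :
    ∃ x K : ℝ, 0 < K ∧ ∃ v : ℂ × (Fin d → ℂ) → ℂ,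
      AnalyticOnNhd ℂ v (sector θ lam ×ˢ ball 0 R) ∧
      (∀ ξ ∈ truncSector q θ r lam 0, ∀ z ∈ ball (0 : Fin d → ℂ) R, v (ξ, z) = borelSum q X ξ z) ∧
      ∀ n, ∀ ξ ∈ truncSector q θ r lam n, ∀ z ∈ ball (0 : Fin d → ℂ) R,
        ‖v (ξ, z)‖ ≤ K * gaussGrowth q x n := by
  classical
  have hq := h.eqn.q_pos
  have hA := h.eqn.one_le_A
  have hB := h.eqn.one_le_B
  have hC := h.one_le_C
  have hr := h.r_pos
  have hε := h.eps_pos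
  set ε' : ℝ := ε * (r / q) ^ (m - m₀)
  have hε' : 0 < ε' := by positivity
  set D : ℝ := (indexSet d m δ).card * (4 * (A * C * B ^ m * 2 ^ (m + 1)))
  have hD : 0 ≤ D := by positivity
  -- The bound `1 / 2` makes the series converge; `ε' / (D + 1)` makes the perturbation use at most
  -- half of the allowed growth.
  obtain ⟨x, hx0, hx⟩ := exists_mul_rpow_le (e := min (1 / 2) (ε' / (D + 1))) h.eqn.one_lt_q
    (by linarith : 0 < B) (by positivity)
  have hx1 : D * (B * q ^ (1 / 2 - x)) ≤ ε' := by
    have h1 := hx.trans (min_le_right _ _)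
    rw [le_div_iff₀ (by positivity)] at h1
    have : 0 ≤ B * q ^ (1 / 2 - x) := by positivity
    linarith
  set K : ℝ := max K₀ (4 * A / ε')
  have hK : 0 < K := lt_of_lt_of_le (by positivity) (le_max_right _ _)
  have hK1 : 4 * A ≤ ε' * K := by
    rw [← div_le_iff₀' hε']
    exact le_max_right _ _
  have hspec := h.approxExtension_spec hx0 (hx.trans (min_le_left _ _)) hK.le (le_max_left _ _)
    hK1 hx1
  have hrad : ∀ k, ball (0 : Fin d → ℂ) R ⊆ ball 0 (radius R κ k) := fun k =>
    ball_subset_ball (lt_radius h.R_pos h.one_lt_kappa k).le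
  have hstable : ∀ k l, k ≤ l → ∀ ξ ∈ truncSector q θ r lam k, ∀ z ∈ ball (0 : Fin d → ℂ) R,
      approxExtension q δ m m₀ c F X l ξ z = approxExtension q δ m m₀ c F X k ξ z := by
    intro k l hkl ξ hξ z hz
    induction l, hkl using Nat.le_induction with
    | base => rfl
    | succ l hkl ih =>
      rw [(hspec l).2.2.2 ξ (h.truncSector_mono hkl hξ) z (hrad l hz), ih]
  -- The approximations are glued; by `hstable` the value does not depend on the chosen index.
  let v : ℂ × (Fin d → ℂ) → ℂ := fun w =>
    if hw : ∃ k, w.1 ∈ truncSector q θ r lam k then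
      approxExtension q δ m m₀ c F X (Nat.find hw) w.1 w.2 else 0
  have hv : ∀ k, ∀ ξ ∈ truncSector q θ r lam k, ∀ z ∈ ball (0 : Fin d → ℂ) R,
      v (ξ, z) = approxExtension q δ m m₀ c F X k ξ z := by
    intro k ξ hξ z hz
    have hw : ∃ k, ξ ∈ truncSector q θ r lam k := ⟨k, hξ⟩
    have : v (ξ, z) = approxExtension q δ m m₀ c F X (Nat.find hw) ξ z := dif_pos hw
    rw [this]
    exact (hstable _ k (Nat.find_min' hw hξ) ξ (Nat.find_spec hw) z hz).symm
  refine ⟨x, K, hK, v, ?_, hv 0, fun n ξ hξ z hz => ?_⟩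
  · rintro ⟨ξ, z⟩ ⟨hξ, hz⟩
    obtain ⟨k, hk⟩ := h.exists_mem_truncSector hξ
    refine ((hspec k).1 (ξ, z) ⟨hk, hrad k hz⟩).congr ?_
    filter_upwards [((h.isOpen_truncSector k).prod isOpen_ball).mem_nhds
      (⟨hk, hz⟩ : (ξ, z) ∈ truncSector q θ r lam k ×ˢ ball 0 R)] with w hw
    exact (hv k w.1 hw.1 w.2 hw.2).symm
  · rw [hv n ξ hξ z hz]
    exact (hspec n).2.2.1 n le_rfl ξ hξ z (hrad n hz)

end SectorSetup

/-! ### Assembling the local data and the final estimate. -/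

theorem gaussGrowth_add {q : ℝ} (hq : 0 < q) (x s : ℝ) (n : ℕ) :
    gaussGrowth q x (n + s) = q ^ ((s + x) ^ 2 / 2) * (q ^ (s + x)) ^ n * q ^ ((n : ℝ) ^ 2 / 2) := by
  rw [gaussGrowth, ← Real.rpow_mul_natCast hq.le, ← Real.rpow_add hq, ← Real.rpow_add hq]
  ring_nf

theorem NormalizedEquation.exists_sectorSetup {q δ : ℝ} {m m₀ : ℕ}
    {c : ℕ × (Fin d → ℕ) → ℕ → (Fin d → ℂ) → ℂ} {F X : ℕ → (Fin d → ℂ) → ℂ} {ρ A B : ℝ}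
    (h : NormalizedEquation q δ m m₀ c F X ρ A B) {lam : ℂ} (hlam : lam ≠ 0)
    (hroot : ∀ x : ℝ, 0 < x → mainPoly q m m₀ c (x * lam) 0 ≠ 0) :
    ∃ θ R κ C K₀ ε r : ℝ, SectorSetup q δ m m₀ c F X ρ A B lam θ R κ C K₀ ε r ∧
      ∀ ξ ∈ ball (0 : ℂ) r, ∀ z ∈ ball (0 : Fin d → ℂ) R,
        Summable fun k => borelCoeff q X k z * ξ ^ k := by
  obtain ⟨ρ₁, K, η, hρ₁, hρ₁ρ, hK, hη, hu⟩ := h.exists_norm_borelCoeff_le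
  obtain ⟨θ, ρ₂, ε, hθ, hθπ, hρ₂, -, hε, hP⟩ := h.exists_le_norm_mainPoly hlam hroot
  obtain ⟨L, hL, hlen⟩ := exists_len_le d m δ
  obtain ⟨κ, hκ, hκL⟩ := exists_pow_eq h.one_lt_q hL
  set R : ℝ := min ρ₁ ρ₂ / 2 with hRdef
  have hR : 0 < R := by positivity
  have hR1 : 2 * R ≤ ρ₁ := by linarith [min_le_left ρ₁ ρ₂]
  have hR2 : 2 * R ≤ ρ₂ := by linarith [min_le_right ρ₁ ρ₂]
  obtain ⟨C, hC, hder⟩ := exists_norm_multiDz_le_radius (d := d) hR hκ hL hκL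
  have hB : 0 < B := by linarith [h.one_le_B]
  -- `r ≤ 1` gives `‖ξ‖ ≤ q ^ n` on the `n`-th truncated sector; the other bounds dominate the Borel
  -- series and the coefficient series by powers of `1 / 2`.
  set r : ℝ := min 1 (min (1 / 2 / η) (1 / 2 / B))
  have hr : 0 < r := by positivity
  have hrη : r * η ≤ 1 / 2 :=
    (le_div_iff₀ hη).1 ((min_le_right _ _).trans (min_le_left _ _))
  have hrB : r * B ≤ 1 / 2 :=
    (le_div_iff₀ hB).1 ((min_le_right _ _).trans (min_le_right _ _))
  have hsub : ball (0 : Fin d → ℂ) (2 * R) ⊆ ball 0 ρ₁ := ball_subset_ball hR1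
  refine ⟨θ, R, κ, C, 2 * K, ε, r, ?_, fun ξ hξ z hz => ?_⟩
  · exact
    { eqn := h
      lam_ne := hlam
      theta_pos := hθ
      theta_le := hθπ
      R_pos := hR
      two_R_le := hR1.trans hρ₁ρ
      one_lt_kappa := hκ
      one_le_C := hC
      derivative_le := fun p hp => hder p.2 (hlen p hp)
      r_pos := hr
      r_le_one := min_le_left _ _
      eps_pos := hε
      analytic_u := (h.analyticOnNhd_borelSum hρ₁ρ hK hη hrη hu).mono
        (Set.prod_mono subset_rfl hsub)
      norm_u_le := fun ξ hξ z hz =>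
        norm_borelSum_le hK hη hrη hu (mem_ball_zero_iff.1 hξ).le (hsub hz)
      equation_u := fun ξ hξ z hz =>
        h.borelSum_equation hρ₁ρ hK hη hrη hrB hu (mem_ball_zero_iff.1 hξ).le (hsub hz)
      le_norm_mainPoly := fun ξ hξ z hz => hP ξ hξ z (ball_subset_ball hR2 hz) }
  · exact .of_norm_bounded (summable_half K) fun n =>
      norm_borelCoeff_mul_pow_le hK hη hrη hu (mem_ball_zero_iff.1 hξ).le n
        (hsub (ball_subset_ball (by linarith) hz))

end QDiffDiff

theorem proposition2p4 (d : ℕ) (q δ : ℝ) (hq : 1 < q) (hδ : 0 < δ)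
    (m : ℕ) (hm : 1 ≤ m)
    (a : ℕ × (Fin d → ℕ) → ℂ × (Fin d → ℂ) → ℂ) (F : ℂ × (Fin d → ℂ) → ℂ)
    (ha : ∀ p ∈ indexSet d m δ, AnalyticAt ℂ (a p) (0, 0))
    (hF : AnalyticAt ℂ F (0, 0))
    (R : ℝ) (hR : 0 < R) (X : ℕ → (Fin d → ℂ) → ℂ)
    (hX : ∀ n, AnalyticOnNhd ℂ (X n) (polydisc d R))
    (hsol : IsFormalSolution q δ m a F X)
    (m₀ : ℕ) (hm₀ : m₀ < m)
    (hA1 : CondA1 δ m m₀ a) (hA2 : CondA2 δ m a)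
    (ha₀ : a (m₀, 0) (0, 0) ≠ 0) (hb₀ : bFun m₀ a m (0, 0) ≠ 0)
    (lam : ℂ) (hlam : lam ≠ 0) (hS : lam ∉ singularDirections q m m₀ a) :
    ∃ θ R₁ r C H : ℝ, 0 < θ ∧ 0 < R₁ ∧ R₁ < R ∧ 0 < r ∧ 0 < C ∧ 0 < H ∧
      -- `u` converges near the origin
      (∀ ξ ∈ Metric.ball (0 : ℂ) r, ∀ z ∈ polydisc d R₁, Summable (borelTerm q X ξ z)) ∧
      AnalyticOnNhd ℂ (qBorel q X) (Metric.ball (0 : ℂ) r ×ˢ polydisc d R₁) ∧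
      -- `u` has an analytic extension to the sector, with the growth estimate
      ∃ uStar : ℂ × (Fin d → ℂ) → ℂ,
        AnalyticOnNhd ℂ uStar (sector θ lam ×ˢ polydisc d R₁) ∧
        (∀ ξ ∈ sector θ lam ∩ Metric.ball (0 : ℂ) r, ∀ z ∈ polydisc d R₁,
          uStar (ξ, z) = qBorel q X (ξ, z)) ∧
        ∀ n : ℕ, ∀ z ∈ polydisc d R₁,
          ‖uStar (lam * (q : ℂ) ^ n, z)‖ ≤ C * H ^ n * q ^ ((n : ℝ) ^ 2 / 2) := by
  have hq0 : 0 < q := by linarith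
  obtain ⟨ρ, A, B, hρR, h⟩ := exists_normalizedEquation hq hδ ha hF hR hX hsol hm₀ hA1 hA2 ha₀ hb₀
  have hroot : ∀ x : ℝ, 0 < x →
      mainPoly q m m₀ (fun p i => tCoeff (a p) i) (x * lam) 0 ≠ 0 := by
    intro x hx h0
    rw [mainPoly_tCoeff q hm₀] at h0
    have hxC : (x : ℂ) ≠ 0 := by exact_mod_cast hx.ne'
    -- A root on the half-line through `lam` would place `lam` in `S`, as a positive multiple of
    -- that root.
    refine hS ⟨x * lam, h0, x⁻¹, inv_pos.2 hx, ?_⟩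
    push_cast
    field_simp
  obtain ⟨θ, R₁, κ, C, K₀, ε, r, hs, hsum⟩ := h.exists_sectorSetup hlam hroot
  obtain ⟨x, K, hK, v, hv, hvu, hbound⟩ := hs.exists_extension
  obtain ⟨k, hk⟩ := hs.exists_mem_truncSector (self_mem_sector hs.theta_pos hlam)
  -- If `lam` lies in the `k`-th truncated sector, then `lam * q ^ n` lies in the `(n + k)`-th.
  -- Expanding `(n + k + x)² / 2` separates the constant `C`, the power `H ^ n` and `q ^ (n² / 2)`.
  refine ⟨θ, R₁, r, K * q ^ (((k : ℝ) + x) ^ 2 / 2), q ^ ((k : ℝ) + x), hs.theta_pos, hs.R_pos,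
    by linarith [hs.two_R_le, hs.R_pos], hs.r_pos, by positivity, by positivity, ?_⟩
  rw [polydisc_eq_ball hs.R_pos]
  refine ⟨hsum, ?_, v, hv, fun ξ hξ z hz => hvu ξ ?_ z hz, fun n z hz => ?_⟩
  · exact hs.analytic_u.mono (Set.prod_mono subset_rfl
      (Metric.ball_subset_ball (by linarith [hs.R_pos])))
  · rwa [truncSector, pow_zero, mul_one]
  · have hmem : lam * (q : ℂ) ^ n ∈ truncSector q θ r lam (n + k) := by
      refine ⟨?_, ?_⟩
      · have := mul_mem_sector hk.1 (pow_pos hq0 n)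
        rwa [Complex.ofReal_pow, mul_comm] at this
      · have := mem_ball_zero_iff.1 hk.2
        rw [mem_ball_zero_iff, norm_mul, norm_pow, Complex.norm_real, Real.norm_of_nonneg hq0.le,
          pow_add, ← mul_assoc, mul_right_comm]
        gcongr
    refine (hbound _ _ hmem z hz).trans (le_of_eq ?_)
    rw [Nat.cast_add, gaussGrowth_add hq0]
    ring
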